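/- **Theorem 1.** There are absolute constants $C,c>0$ such that the following holds. Let $M\ge 1$, $0\le D\le M$, $b\ge 0$ be integers, let $\mathrm{dec}:\{0,1\}^b\to\mathbb C$ be any fixed encoding of numbers by $b$-bit strings, and let $\Lambda,\Lambda_{\max},t,\zeta\ge 0$ and $\delta\in(0,1]$ be real numbers with $D\,t\,\zeta\le c\,\delta$. There is a quantum query algorithm (depending only on these data) that makes at most $$C\left(\frac{\Lambda t}{\sqrt\delta}+D\Lambda_{\max}t+1\right)$$ queries in total to $O_H$, $O_F$ and $O_F^{-1}$ and simulates evolution under $H$ for time $t$ with error at most $\delta$, for every Hermitian $H\in\mathbb C^{M\times M}$ with spectral norm $\|H\|\le\Lambda$ and $\|H\|_{\max}:=\max_{j,k}|H_{jk}|\le\Lambda_{\max}$ and all oracles of the following kind: * $O_H|j,k\rangle|z\rangle=|j,k\rangle|z\oplus h(j,k)\rangle$ for $j,k\in\{1,\dots,M\}$ and $z\in\{0,1\}^b$, where the bit string $h(j,k)$ gives the entry $H_{jk}$ to precision $\zeta$: $|\mathrm{dec}(h(j,k))-H_{jk}|\le\zeta$ (in particular the case $\zeta=0$ of exactly given entries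 is included, without any condition on $D$, $t$ and $\delta$); * $O_F$ is a unitary on $\mathbb C^M\otimes\mathbb C^M$ with $O_F|j,k\rangle=|j,f(j,k)\rangle$ for $j\in\{1,\dots,M\}$ and $k\in\{1,\dots,D\}$, where $f(j,1),\dots,f(j,D)$ are distinct row indices that include those of all nonzero entries of column $j$ of $H$ (so $H$ has at most $D$ nonzero entries in every row and column). Here a query algorithm appends finitely many ancillas in a fixed basis state to its $M$-dimensional input, alternates queries with unitaries that do not depend on the oracles, and finally discards the ancillas; it simulates evolution under $H$ for time $t$ with error at most $\delta$ if for every density matrix $\rho$ on $\mathbb C^M$ its output has trace distance at most $\delta$ from $e^{-iHt}\rho\,e^{iHt}$. -/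

import Mathlib

open scoped Kronecker ComplexOrder

noncomputable section

namespace HamSim

/-! ### Norms, states and the trace distance -/

/-- The spectral norm: the operator norm with respect to the Euclidean norm. -/
def specNorm {M : ℕ} (H : Matrix (Fin M) (Fin M) ℂ) : ℝ :=
  ‖Matrix.toEuclideanCLM (n := Fin M) (𝕜 := ℂ) H‖

/-- The largest absolute value of an entry. -/
def maxNorm {M : ℕ} (H : Matrix (Fin M) (Fin M) ℂ) : ℝ :=
  ⨆ p : Fin M × Fin M, ‖H p.1 p.2‖

/-- The trace norm: the sum of the singular values, i.e. of the square roots of the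
eigenvalues of `Aᴴ A`. -/
def traceNorm {n : Type*} [Fintype n] [DecidableEq n] (A : Matrix n n ℂ) : ℝ :=
  ∑ i, Real.sqrt ((Matrix.isHermitian_conjTranspose_mul_self A).eigenvalues i)

/-- The trace distance `½ ‖ρ - σ‖₁`. -/
def traceDist {n : Type*} [Fintype n] [DecidableEq n] (ρ σ : Matrix n n ℂ) : ℝ :=
  (1 / 2) * traceNorm (ρ - σ)

/-- Density matrices. -/
def IsDensity {n : Type*} [Fintype n] (ρ : Matrix n n ℂ) : Prop :=
  ρ.PosSemidef ∧ ρ.trace = 1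

/-- The partial trace over the second tensor factor. -/
def traceOutRight {m n : Type*} [Fintype n] (ρ : Matrix (m × n) (m × n) ℂ) : Matrix m m ℂ :=
  Matrix.of fun i i' => ∑ a, ρ (i, a) (i', a)

/-- The evolution operator `e^{-iHt}`. -/
def evolution {M : ℕ} (H : Matrix (Fin M) (Fin M) ℂ) (t : ℝ) : Matrix (Fin M) (Fin M) ℂ :=
  NormedSpace.exp ((-(Complex.I * (t : ℂ))) • H)

/-! ### Oracles -/

/-- Bit strings of length `b`; addition is the bitwise exclusive or. -/
abbrev Bits (b : ℕ) : Type := Fin b → ZMod 2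

/-- The matrix-element oracle `|j,k⟩|z⟩ ↦ |j,k⟩|z ⊕ h(j,k)⟩`, where the bit string `h j k`
encodes the entry in row `j` and column `k`. -/
def oracleH {M b : ℕ} (h : Fin M → Fin M → Bits b) :
    Matrix ((Fin M × Fin M) × Bits b) ((Fin M × Fin M) × Bits b) ℂ :=
  Matrix.of fun x y => if x.1 = y.1 ∧ x.2 = y.2 + h y.1.1 y.1.2 then 1 else 0

/-- `OF` is a sparsity oracle for `H`: a unitary with `OF |j,k⟩ = |j, f(j,k)⟩` for all `j` and
for the first `D` values of `k`, where the rows `f(j,1), …, f(j,D)` contain the positions of all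
nonzero entries of column `j`. (Unitarity makes `f(j,·)` injective. On the remaining values of `k`
nothing else is prescribed.) -/
def IsSparsityOracle {M D : ℕ} (hD : D ≤ M) (H : Matrix (Fin M) (Fin M) ℂ)
    (OF : Matrix (Fin M × Fin M) (Fin M × Fin M) ℂ) : Prop :=
  OF ∈ Matrix.unitaryGroup (Fin M × Fin M) ℂ ∧
  ∃ f : Fin M → Fin D → Fin M,
    (∀ (j : Fin M) (k : Fin D) (x : Fin M × Fin M),
      OF x (j, Fin.castLE hD k) = if x = (j, f j k) then 1 else 0) ∧
    ∀ i j : Fin M, H i j ≠ 0 → ∃ k : Fin D, f j k = i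

/-! ### Query algorithms -/

/-- Basis of the ancilla space: the registers `j, k` and `z` on which the oracles act, and an
additional workspace with basis `W`. -/
abbrev Ancilla (M b : ℕ) (W : Type) : Type := ((Fin M × Fin M) × Bits b) × W

/-- Basis of the whole space: the `M`-dimensional system, and the ancillas. -/
abbrev Reg (M b : ℕ) (W : Type) : Type := Fin M × Ancilla M b W

/-- The elementary steps: an arbitrary fixed unitary, which does not depend on the oracles, or one
query to `O_H` (which is its own inverse), to `O_F` or to the inverse of `O_F`. -/
inductive Gate (M b : ℕ) (W : Type) [Fintype W] [DecidableEq W] : Type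
  | free (U : Matrix.unitaryGroup (Reg M b W) ℂ) : Gate M b W
  | queryH : Gate M b W
  | queryF : Gate M b W
  | queryFinv : Gate M b W

/-- The operator that a step performs. -/
def Gate.op {M b : ℕ} {W : Type} [Fintype W] [DecidableEq W]
    (h : Fin M → Fin M → Bits b) (OF : Matrix (Fin M × Fin M) (Fin M × Fin M) ℂ) :
    Gate M b W → Matrix (Reg M b W) (Reg M b W) ℂ
  | .free U => U.1
  | .queryH =>
      (1 : Matrix (Fin M) (Fin M) ℂ) ⊗ₖ (oracleH h ⊗ₖ (1 : Matrix W W ℂ))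
  | .queryF =>
      (1 : Matrix (Fin M) (Fin M) ℂ) ⊗ₖ
        ((OF ⊗ₖ (1 : Matrix (Bits b) (Bits b) ℂ)) ⊗ₖ (1 : Matrix W W ℂ))
  | .queryFinv =>
      (1 : Matrix (Fin M) (Fin M) ℂ) ⊗ₖ
        ((OF.conjTranspose ⊗ₖ (1 : Matrix (Bits b) (Bits b) ℂ)) ⊗ₖ (1 : Matrix W W ℂ))

/-- The number of queries that a step makes. -/
def Gate.cost {M b : ℕ} {W : Type} [Fintype W] [DecidableEq W] : Gate M b W → ℕ
  | .free _ => 0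
  | .queryH => 1
  | .queryF => 1
  | .queryFinv => 1

/-- A quantum query algorithm that acts on an `M`-dimensional system: a finite workspace, a basis
state in which all ancillas are initialised, and a list of steps, the first of which is performed
first. -/
structure QueryAlgorithm (M b : ℕ) where
  W : Type
  [fintypeW : Fintype W]
  [decidableEqW : DecidableEq W]
  start : Ancilla M b W
  gates : List (Gate M b W)

attribute [instance] QueryAlgorithm.fintypeW QueryAlgorithm.decidableEqW

/-- The total number of queries, to all oracles together. -/
def QueryAlgorithm.queries {M b : ℕ} (A : QueryAlgorithm M b) : ℕ :=
  (A.gates.map Gate.cost).sum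

/-- The operator performed by the whole algorithm. -/
def QueryAlgorithm.op {M b : ℕ} (A : QueryAlgorithm M b)
    (h : Fin M → Fin M → Bits b) (OF : Matrix (Fin M × Fin M) (Fin M × Fin M) ℂ) :
    Matrix (Reg M b A.W) (Reg M b A.W) ℂ :=
  A.gates.foldl (fun U g => g.op h OF * U) 1

/-- The output on the input state `ρ`: the ancillas are appended in their initial state, the steps
are performed, and the ancillas are traced out. -/
def QueryAlgorithm.run {M b : ℕ} (A : QueryAlgorithm M b)
    (h : Fin M → Fin M → Bits b) (OF : Matrix (Fin M × Fin M) (Fin M × Fin M) ℂ)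
    (ρ : Matrix (Fin M) (Fin M) ℂ) : Matrix (Fin M) (Fin M) ℂ :=
  traceOutRight
    (A.op h OF * (ρ ⊗ₖ Matrix.single A.start A.start (1 : ℂ)) * (A.op h OF).conjTranspose)

/-- Run with the given oracles, the algorithm simulates evolution under `H` for time `t` with
error at most `δ` in trace distance, whatever the input state. -/
def QueryAlgorithm.Simulates {M b : ℕ} (A : QueryAlgorithm M b)
    (h : Fin M → Fin M → Bits b) (OF : Matrix (Fin M × Fin M) (Fin M × Fin M) ℂ)
    (H : Matrix (Fin M) (Fin M) ℂ) (t δ : ℝ) : Prop :=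
  ∀ ρ : Matrix (Fin M) (Fin M) ℂ, IsDensity ρ →
    traceDist (A.run h OF ρ) (evolution H t * ρ * (evolution H t).conjTranspose) ≤ δ

end HamSim

end

/-! Up to the precision of the data, H / (D·Lm) is a block of a Hermitian unitary U that costs four
queries (`exists_preparation`, `norm_encodedMatrix_sub_le`). On this block the evolution is
exp(-iτy) with τ = D·Lm·t. It has to be approximated by a polynomial that is bounded by one on all
of [-1, 1], but accurate only on the spectrum, where |τy| is at most about La·t.
`exists_evolution_polynomial` achieves this with degree O(La·t/√δ + τ + 1). The Taylor polynomial
with K terms has error at most 2(3x/K)^K where |τy| ≤ x ≤ K/2. Taking K ≥ 6τ bounds it by two on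
[-1, 1], and K ≥ 12x/√δ makes the error O(δ) near the spectrum, because two of the K factors already
contribute √δ each. The cubic p ↦ (3p - p|p|²)/2 maps the disk of radius two into the unit disk and
fixes the unit circle, so it restores the bound and keeps the error O(δ).

To apply such a polynomial q of degree at most d, let R be the reflection about the encoding
subspace and W = RU. Then (W + W⁻¹)/2 preserves that subspace and acts on it as the encoded matrix,
so q of the block is a block of W⁻ᵈ P(W), where P = `walkPolynomial d q` has degree at most 2d and
modulus below one on the unit circle. Fejér–Riesz supplies Q with |P|² + |Q|² = 1 there
(`exists_complementary_polynomial`). Stripping one degree at a time factors the column (P, Q) into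
rotations of a control qubit that alternate with controlled W (`exists_signal_sequence`). This gives
`exists_transformation_algorithm`, with 12d queries.

No amplitude amplification is needed: a block within κ of a unitary leaves only weight O(κ) on the
other ancilla states, so discarding the ancillas gives trace distance at most 2κ
(`traceDist_traceOutRight_le`). Imprecise entries are absorbed by `norm_evolution_sub_le`. -/

namespace HamSim

/-! ### Fejér–Riesz factorization and signal processing on the unit circle -/

section Polynomials

open Polynomial

/-- The polynomial `X ^ N * conj (P (1 / conj X))`. -/
noncomputable def conjReflect (N : ℕ) (P : ℂ[X]) : ℂ[X] := (P.map (starRingEnd ℂ)).reflect N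

lemma eval_conjReflect {N : ℕ} {P : ℂ[X]} (hP : P.natDegree ≤ N) {z : ℂ} (hz : z ≠ 0) :
    (conjReflect N P).eval z = z ^ N * starRingEnd ℂ (P.eval (starRingEnd ℂ z)⁻¹) := by
  let : Invertible z⁻¹ := invertibleOfNonzero (inv_ne_zero hz)
  have h := eval₂_reflect_mul_pow (RingHom.id ℂ) z⁻¹ N (P.map (starRingEnd ℂ))
    (natDegree_map_le.trans hP)
  have h1 : ⅟(z⁻¹) = z := by rw [invOf_eq_inv, inv_inv]
  rw [h1] at h
  simp only [eval₂_id] at h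
  have h2 : (P.map (starRingEnd ℂ)).eval z⁻¹ = starRingEnd ℂ (P.eval (starRingEnd ℂ z)⁻¹) := by
    rw [eval_map, ← eval₂_hom, map_inv₀, Complex.conj_conj]
  rw [h2] at h
  rw [conjReflect, ← h, mul_left_comm, ← mul_pow, mul_inv_cancel₀ hz, one_pow, mul_one]

lemma inv_conj_of_norm_one {z : ℂ} (hz : ‖z‖ = 1) : (starRingEnd ℂ z)⁻¹ = z := by
  have h : z * starRingEnd ℂ z = 1 := by rw [Complex.mul_conj']; simp [hz]
  exact (eq_inv_of_mul_eq_one_left h).symm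

lemma ne_zero_of_norm_one {z : ℂ} (hz : ‖z‖ = 1) : z ≠ 0 := by
  rintro rfl; simp at hz

lemma eval_conjReflect_circle {N : ℕ} {P : ℂ[X]} (hP : P.natDegree ≤ N) {z : ℂ} (hz : ‖z‖ = 1) :
    (conjReflect N P).eval z = z ^ N * starRingEnd ℂ (P.eval z) := by
  rw [eval_conjReflect hP (ne_zero_of_norm_one hz), inv_conj_of_norm_one hz]

lemma infinite_circle : {z : ℂ | ‖z‖ = 1}.Infinite := by
  have h : {z : ℂ | ‖z‖ = 1} = Metric.sphere (0 : ℂ) 1 := by ext z; simp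
  rw [h]
  refine (isPreconnected_sphere (by simp) 0 1).infinite_of_nontrivial
    ⟨1, by simp, -1, by simp, ?_⟩
  intro h
  have := congrArg Complex.re h
  norm_num at this

lemma eq_of_eval_eq_on_circle {P Q : ℂ[X]} (h : ∀ z : ℂ, ‖z‖ = 1 → P.eval z = Q.eval z) :
    P = Q :=
  eq_of_infinite_eval_eq P Q (infinite_circle.mono fun z hz => h z hz)

lemma natDegree_conjReflect_le {N : ℕ} {P : ℂ[X]} (hP : P.natDegree ≤ N) :
    (conjReflect N P).natDegree ≤ N := by
  rw [natDegree_le_iff_coeff_eq_zero]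
  intro k hk
  rw [conjReflect, coeff_reflect, revAt_eq_self_of_lt hk, coeff_map,
    coeff_eq_zero_of_natDegree_lt (hP.trans_lt hk), map_zero]

/-- The Fejér–Riesz theorem, for trigonometric polynomials that are strictly positive on the
unit circle. -/
theorem exists_spectral_factor (N : ℕ) : ∀ F : ℂ[X], F.natDegree ≤ 2 * N →
    (∀ z : ℂ, ‖z‖ = 1 → ∃ a : ℝ, 0 < a ∧ F.eval z = a * z ^ N) →
    ∃ Q : ℂ[X], Q.natDegree ≤ N ∧ ∀ z : ℂ, ‖z‖ = 1 → F.eval z = (‖Q.eval z‖ ^ 2 : ℝ) * z ^ N := by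
  induction N with
  | zero =>
    intro F hF hpos
    obtain ⟨c, hc⟩ : ∃ c, F = C c := ⟨_, eq_C_of_natDegree_le_zero (by simpa using hF)⟩
    obtain ⟨a, ha, hFa⟩ := hpos 1 (by simp)
    refine ⟨C (Real.sqrt a : ℂ), by simp, fun z _ => ?_⟩
    have hca : c = a := by simpa [hc] using hFa
    simp [hc, hca, Real.sq_sqrt ha.le, abs_of_nonneg (Real.sqrt_nonneg a)]
  | succ N ih =>
    intro F hF hpos
    -- Realness of F(z)/z^(N+1) on the circle makes F self-reciprocal: the lowest and highest
    -- coefficients vanish together, and nonzero roots come in pairs r, 1/conj r.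
    have hself : conjReflect (2 * (N + 1)) F = F := by
      refine eq_of_eval_eq_on_circle fun z hz => ?_
      obtain ⟨a, _, hFa⟩ := hpos z hz
      rw [eval_conjReflect_circle hF hz, hFa, map_mul, Complex.conj_ofReal, map_pow, two_mul,
        pow_add]
      have h1 : z ^ (N + 1) * (starRingEnd ℂ z) ^ (N + 1) = 1 := by
        rw [← mul_pow, Complex.mul_conj', hz]; simp
      linear_combination (a : ℂ) * z ^ (N + 1) * h1
    by_cases h0 : F.coeff 0 = 0
    · have htop : F.coeff (2 * (N + 1)) = 0 := by
        rw [← hself, conjReflect, coeff_reflect, revAt_le le_rfl, coeff_map]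
        simp [h0]
      obtain ⟨F', rfl⟩ := X_dvd_iff.2 h0
      have hF' : F'.natDegree ≤ 2 * N := by
        rw [natDegree_le_iff_coeff_eq_zero]
        intro k hk
        rw [← coeff_X_mul]
        rcases Nat.lt_or_ge (k + 1) (2 * (N + 1)) with h | h
        · omega
        · rcases h.eq_or_lt with h | h
          · rw [← h]; exact htop
          · exact coeff_eq_zero_of_natDegree_lt (hF.trans_lt h)
      obtain ⟨Q, hQ, hQz⟩ := ih F' hF' fun z hz => by
        obtain ⟨a, ha, h⟩ := hpos z hz
        refine ⟨a, ha, mul_left_cancel₀ (ne_zero_of_norm_one hz) ?_⟩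
        simp only [eval_mul, eval_X] at h
        rw [h]; ring
      refine ⟨Q, hQ.trans (Nat.le_succ N), fun z hz => ?_⟩
      rw [eval_mul, eval_X, hQz z hz]; ring
    · have htop : F.coeff (2 * (N + 1)) ≠ 0 := by
        rw [← hself, conjReflect, coeff_reflect, revAt_le le_rfl, coeff_map]
        simpa using h0
      have hdeg : F.natDegree = 2 * (N + 1) := le_antisymm hF (le_natDegree_of_ne_zero htop)
      have hF0 : F ≠ 0 := by rintro rfl; simp at h0
      obtain ⟨r, hr⟩ := Complex.exists_root (f := F) (by
        rw [← natDegree_pos_iff_degree_pos]; omega)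
      have hr0 : r ≠ 0 := by
        rintro rfl
        rw [IsRoot, ← coeff_zero_eq_eval_zero] at hr
        exact h0 hr
      -- Strict positivity keeps roots off the circle, so r differs from its mirror image and both
      -- can be divided out.
      have hr1 : ‖r‖ ≠ 1 := by
        intro h
        obtain ⟨a, ha, hFa⟩ := hpos r h
        rw [hr.eq_zero] at hFa
        simp [ha.ne', hr0] at hFa
      have hcr0 : starRingEnd ℂ r ≠ 0 := by simpa using hr0
      have hr' : F.eval (starRingEnd ℂ r)⁻¹ = 0 := by
        have h := hr.eq_zero
        rw [← hself, eval_conjReflect hF hr0] at h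
        simpa [hr0] using h
      have hne : (starRingEnd ℂ r)⁻¹ ≠ r := by
        intro h
        have h2 : r * starRingEnd ℂ r = 1 := by
          nth_rewrite 1 [← h]; exact inv_mul_cancel₀ hcr0
        rw [Complex.mul_conj'] at h2
        have h3 : ‖r‖ ^ 2 = 1 := by exact_mod_cast h2
        exact hr1 (by nlinarith [norm_nonneg r])
      obtain ⟨F₁, rfl⟩ := dvd_iff_isRoot.2 hr
      have hF₁ : F₁.IsRoot (starRingEnd ℂ r)⁻¹ := by
        rw [eval_mul] at hr'
        rcases mul_eq_zero.1 hr' with h | h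
        · exact absurd (by simpa [sub_eq_zero] using h) hne
        · exact h
      obtain ⟨F₂, rfl⟩ := dvd_iff_isRoot.2 hF₁
      have hF₂0 : F₂ ≠ 0 := by rintro rfl; simp at hF0
      rw [natDegree_mul (X_sub_C_ne_zero _) (mul_ne_zero (X_sub_C_ne_zero _) hF₂0),
        natDegree_mul (X_sub_C_ne_zero _) hF₂0, natDegree_X_sub_C, natDegree_X_sub_C] at hdeg
      -- The pair of roots contributes |z - r|² and one power of z. The remaining constant -1/conj r
      -- goes into the quotient, which is then positive again.
      have key : ∀ z : ℂ, ‖z‖ = 1 →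
          (z - r) * (z - (starRingEnd ℂ r)⁻¹) = -(z / starRingEnd ℂ r) * (‖z - r‖ ^ 2 : ℝ) := by
        intro z hz
        rw [Complex.ofReal_pow, ← Complex.mul_conj', map_sub]
        have h1 : z * starRingEnd ℂ z = 1 := by rw [Complex.mul_conj', hz]; simp
        field_simp
        linear_combination (z - r) * h1
      have hzr : ∀ z : ℂ, ‖z‖ = 1 → 0 < ‖z - r‖ ^ 2 := by
        intro z hz
        have : z - r ≠ 0 := by
          intro h; rw [sub_eq_zero] at h; exact hr1 (h ▸ hz)
        positivity
      obtain ⟨Q, hQ, hQz⟩ := ih (C (-(starRingEnd ℂ r)⁻¹) * F₂)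
        ((natDegree_C_mul_le _ _).trans (by omega)) fun z hz => by
          obtain ⟨a, ha, h⟩ := hpos z hz
          have hk := key z hz
          have hp := hzr z hz
          refine ⟨a / ‖z - r‖ ^ 2, div_pos ha hp, ?_⟩
          simp only [eval_mul, eval_sub, eval_X, eval_C] at h ⊢
          rw [← mul_assoc, hk] at h
          have hp' : ((‖z - r‖ ^ 2 : ℝ) : ℂ) ≠ 0 := by exact_mod_cast hp.ne'
          rw [Complex.ofReal_div, eq_comm, div_mul_eq_mul_div, div_eq_iff hp']
          apply mul_left_cancel₀ (ne_zero_of_norm_one hz)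
          rw [pow_succ] at h
          field_simp at h ⊢
          linear_combination (-1 : ℂ) * h
      refine ⟨(X - C r) * Q, ?_, fun z hz => ?_⟩
      · refine natDegree_mul_le.trans ?_
        rw [natDegree_X_sub_C]; omega
      · have h := hQz z hz
        simp only [eval_mul, eval_sub, eval_X, eval_C] at h ⊢
        rw [← mul_assoc, key z hz, norm_mul, mul_pow, Complex.ofReal_mul, pow_succ z]
        field_simp at h ⊢
        linear_combination ((‖z - r‖ ^ 2 : ℝ) : ℂ) * z * h

/-- Fejér–Riesz is applied to 1 - |P|², multiplied by z^N to become a polynomial. The strict bound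
on P gives the strict positivity required there. -/
lemma exists_complementary_polynomial {N : ℕ} {P : ℂ[X]} (hP : P.natDegree ≤ N)
    (h : ∀ z : ℂ, ‖z‖ = 1 → ‖P.eval z‖ < 1) :
    ∃ Q : ℂ[X], Q.natDegree ≤ N ∧ ∀ z : ℂ, ‖z‖ = 1 → ‖P.eval z‖ ^ 2 + ‖Q.eval z‖ ^ 2 = 1 := by
  have key : ∀ z : ℂ, ‖z‖ = 1 → (X ^ N - P * conjReflect N P).eval z =
      ((1 - ‖P.eval z‖ ^ 2 : ℝ) : ℂ) * z ^ N := fun z hz => by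
    rw [eval_sub, eval_mul, eval_conjReflect_circle hP hz, eval_pow, eval_X]
    push_cast
    rw [← Complex.mul_conj']
    ring
  obtain ⟨Q, hQ, hQz⟩ := exists_spectral_factor N (X ^ N - P * conjReflect N P)
    ((natDegree_sub_le _ _).trans (max_le (by rw [natDegree_X_pow]; omega)
      (natDegree_mul_le.trans (by have := natDegree_conjReflect_le hP; omega))))
    fun z hz => ⟨1 - ‖P.eval z‖ ^ 2, by nlinarith [h z hz, norm_nonneg (P.eval z)], key z hz⟩
  refine ⟨Q, hQ, fun z hz => ?_⟩
  have h1 := mul_right_cancel₀ (pow_ne_zero N (ne_zero_of_norm_one hz))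
    ((key z hz).symm.trans (hQz z hz))
  have h2 : 1 - ‖P.eval z‖ ^ 2 = ‖Q.eval z‖ ^ 2 := by exact_mod_cast h1
  linarith

/-- One step of a signal processing sequence: the signal `diag(X, 1)` followed by a rotation. -/
noncomputable def signalStep (R : Matrix (Fin 2) (Fin 2) ℂ) : Matrix (Fin 2) (Fin 2) ℂ[X] :=
  R.map C * Matrix.diagonal ![X, 1]

lemma rotation_mem_unitaryGroup {a b : ℂ} (h : ‖a‖ ^ 2 + ‖b‖ ^ 2 = 1) :
    !![a, -starRingEnd ℂ b; b, starRingEnd ℂ a] ∈ Matrix.unitaryGroup (Fin 2) ℂ := by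
  have h' : a * starRingEnd ℂ a + b * starRingEnd ℂ b = 1 := by
    rw [Complex.mul_conj', Complex.mul_conj']; exact_mod_cast h
  rw [Matrix.mem_unitaryGroup_iff']
  ext i j
  fin_cases i <;> fin_cases j <;>
    simp [Matrix.mul_apply, Fin.sum_univ_two, Matrix.star_apply] <;>
    first | linear_combination h' | ring

/-- In dimension two a row that kills (p₀, q₀) is proportional to (q₀, -p₀), and orthogonality makes
the companion row kill (p₁, q₁). If p₀ = q₀ = 0, the row is built from (p₁, q₁) instead. -/
lemma exists_annihilating_rotation {p₀ q₀ p₁ q₁ : ℂ}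
    (h : p₀ * starRingEnd ℂ p₁ + q₀ * starRingEnd ℂ q₁ = 0) :
    ∃ a b : ℂ, ‖a‖ ^ 2 + ‖b‖ ^ 2 = 1 ∧ a * p₀ + b * q₀ = 0 ∧
      -starRingEnd ℂ b * p₁ + starRingEnd ℂ a * q₁ = 0 := by
  have normalize : ∀ u v : ℂ, ¬ (u = 0 ∧ v = 0) →
      ∃ s : ℝ, ‖(s : ℂ) * u‖ ^ 2 + ‖(s : ℂ) * v‖ ^ 2 = 1 := by
    intro u v huv
    have hpos : 0 < ‖u‖ ^ 2 + ‖v‖ ^ 2 := by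
      by_cases hu : u = 0
      · have hv : v ≠ 0 := fun hv => huv ⟨hu, hv⟩
        positivity
      · positivity
    refine ⟨(Real.sqrt (‖u‖ ^ 2 + ‖v‖ ^ 2))⁻¹, ?_⟩
    simp only [norm_mul, Complex.norm_real, mul_pow, Real.norm_eq_abs, sq_abs, inv_pow,
      Real.sq_sqrt hpos.le]
    field_simp
  by_cases h0 : q₀ = 0 ∧ -p₀ = 0
  · obtain ⟨hq, hp⟩ := h0
    rw [neg_eq_zero] at hp
    subst hq hp
    by_cases h1 : starRingEnd ℂ p₁ = 0 ∧ starRingEnd ℂ q₁ = 0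
    · rw [map_eq_zero, map_eq_zero] at h1
      exact ⟨1, 0, by simp [h1.1, h1.2]⟩
    · obtain ⟨s, hs⟩ := normalize _ _ h1
      refine ⟨_, _, hs, by simp, ?_⟩
      simp only [map_mul, Complex.conj_ofReal, Complex.conj_conj]; ring
  · obtain ⟨s, hs⟩ := normalize _ _ h0
    refine ⟨_, _, hs, by ring, ?_⟩
    have h' := congrArg (starRingEnd ℂ) h
    simp only [map_add, map_mul, Complex.conj_conj, map_zero] at h'
    simp only [map_mul, map_neg, Complex.conj_ofReal]
    linear_combination (s : ℂ) * h'

/-- Layer stripping: one rotation makes the upper component divisible by X and lowers the degree of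
the lower one. Dividing the upper one by X undoes one signal, and the normalization on the circle
survives. -/
theorem exists_signal_sequence (N : ℕ) : ∀ P Q : ℂ[X], P.natDegree ≤ N → Q.natDegree ≤ N →
    (∀ z : ℂ, ‖z‖ = 1 → ‖P.eval z‖ ^ 2 + ‖Q.eval z‖ ^ 2 = 1) →
    ∃ (l : List (Matrix.unitaryGroup (Fin 2) ℂ)) (R₀ : Matrix.unitaryGroup (Fin 2) ℂ),
      l.length = N ∧
      ((l.map fun R => signalStep R.1).prod * R₀.1.map C) 0 0 = P ∧
      ((l.map fun R => signalStep R.1).prod * R₀.1.map C) 1 0 = Q := by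
  induction N with
  | zero =>
    intro P Q hP hQ h
    obtain ⟨p, rfl⟩ : ∃ c, P = C c := ⟨_, eq_C_of_natDegree_le_zero hP⟩
    obtain ⟨q, rfl⟩ : ∃ c, Q = C c := ⟨_, eq_C_of_natDegree_le_zero hQ⟩
    have h1 := h 1 (by simp)
    simp only [eval_C] at h1
    exact ⟨[], ⟨_, rotation_mem_unitaryGroup h1⟩, by simp⟩
  | succ N ih =>
    intro P Q hP hQ h
    have hpoly : P * conjReflect (N + 1) P + Q * conjReflect (N + 1) Q = X ^ (N + 1) := by
      refine eq_of_eval_eq_on_circle fun z hz => ?_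
      have h1 : ((‖P.eval z‖ : ℂ) ^ 2 + (‖Q.eval z‖ : ℂ) ^ 2) = 1 := by exact_mod_cast h z hz
      rw [← Complex.mul_conj', ← Complex.mul_conj'] at h1
      rw [eval_add, eval_mul, eval_mul, eval_conjReflect_circle hP hz,
        eval_conjReflect_circle hQ hz, eval_pow, eval_X]
      linear_combination z ^ (N + 1) * h1
    -- The normalization at coefficient zero: X^(N+1) has none, and the left side is the inner
    -- product of the lowest and highest coefficient vectors.
    have horth : P.coeff 0 * starRingEnd ℂ (P.coeff (N + 1)) +
        Q.coeff 0 * starRingEnd ℂ (Q.coeff (N + 1)) = 0 := by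
      have h1 := congrArg (fun F => coeff F 0) hpoly
      simpa [mul_coeff_zero, conjReflect, coeff_reflect, revAt_le] using h1
    obtain ⟨a, b, hab, hbot, htop⟩ := exists_annihilating_rotation horth
    have hab' : a * starRingEnd ℂ a + b * starRingEnd ℂ b = 1 := by
      rw [Complex.mul_conj', Complex.mul_conj']; exact_mod_cast hab
    obtain ⟨P', hP'⟩ : X ∣ C a * P + C b * Q := X_dvd_iff.2 (by simpa using hbot)
    have hP'deg : P'.natDegree ≤ N := by
      rw [natDegree_le_iff_coeff_eq_zero]
      intro k hk
      rw [← coeff_X_mul, ← hP', coeff_add, coeff_C_mul, coeff_C_mul,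
        coeff_eq_zero_of_natDegree_lt (by omega), coeff_eq_zero_of_natDegree_lt (by omega)]
      simp
    have hQ'deg : (-C (starRingEnd ℂ b) * P + C (starRingEnd ℂ a) * Q).natDegree ≤ N := by
      rw [natDegree_le_iff_coeff_eq_zero]
      intro k hk
      rw [← C_neg, coeff_add, coeff_C_mul, coeff_C_mul]
      rcases Nat.eq_or_lt_of_le (Nat.succ_le_of_lt hk) with hk' | hk'
      · rw [← hk']; exact htop
      · rw [coeff_eq_zero_of_natDegree_lt (by omega), coeff_eq_zero_of_natDegree_lt (by omega)]
        simp
    obtain ⟨l, R₀, hl, h0, h1⟩ := ih P' _ hP'deg hQ'deg fun z hz => by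
      have hz' : ‖P'.eval z‖ = ‖a * P.eval z + b * Q.eval z‖ := by
        have := congrArg (fun F => ‖eval z F‖) hP'
        simpa [hz] using this.symm
      rw [hz', ← h z hz]
      have : ((‖a * P.eval z + b * Q.eval z‖ ^ 2 +
          ‖(-C (starRingEnd ℂ b) * P + C (starRingEnd ℂ a) * Q).eval z‖ ^ 2 : ℝ) : ℂ) =
          ((‖P.eval z‖ ^ 2 + ‖Q.eval z‖ ^ 2 : ℝ) : ℂ) := by
        push_cast
        simp only [← Complex.mul_conj', eval_add, eval_mul, eval_neg, eval_C, map_add, map_mul,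
          map_neg, Complex.conj_conj]
        linear_combination (P.eval z * starRingEnd ℂ (P.eval z) +
          Q.eval z * starRingEnd ℂ (Q.eval z)) * hab'
      exact_mod_cast this
    -- The rotation put into the list is the inverse of the annihilating one.
    have hrot : ‖starRingEnd ℂ a‖ ^ 2 + ‖starRingEnd ℂ b‖ ^ 2 = 1 := by simpa using hab
    refine ⟨⟨_, rotation_mem_unitaryGroup hrot⟩ :: l, R₀, by simp [hl], ?_, ?_⟩
    · rw [List.map_cons, List.prod_cons, Matrix.mul_assoc, Matrix.mul_apply, Fin.sum_univ_two,
        h0, h1]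
      simp only [signalStep, Matrix.mul_diagonal, Matrix.map_apply]
      simp only [Matrix.of_apply, Matrix.cons_val', Matrix.cons_val_zero, Matrix.cons_val_one,
        Complex.conj_conj, Matrix.cons_val_fin_one, mul_one, C_neg]
      rw [mul_assoc, ← hP']
      have := congrArg C hab'
      simp only [C_add, C_mul, C_1] at this
      linear_combination P * this
    · rw [List.map_cons, List.prod_cons, Matrix.mul_assoc, Matrix.mul_apply, Fin.sum_univ_two,
        h0, h1]
      simp only [signalStep, Matrix.mul_diagonal, Matrix.map_apply]
      simp only [Matrix.of_apply, Matrix.cons_val', Matrix.cons_val_zero, Matrix.cons_val_one,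
        Complex.conj_conj, Matrix.cons_val_fin_one, mul_one]
      rw [mul_assoc, ← hP']
      have := congrArg C hab'
      simp only [C_add, C_mul, C_1] at this
      linear_combination Q * this

end Polynomials

/-! ### Bounded polynomial approximation of the exponential -/

section Approximation

open Polynomial

/-- The polynomial `X ^ d * q ((X + X⁻¹) / 2)`, for `q` of degree at most `d`. -/
noncomputable def walkPolynomial (d : ℕ) (q : ℂ[X]) : ℂ[X] :=
  ∑ k ∈ Finset.range (d + 1), C (q.coeff k * (1 / 2) ^ k) * ((X ^ 2 + 1) ^ k * X ^ (d - k))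

lemma natDegree_walkPolynomial_le (d : ℕ) (q : ℂ[X]) :
    (walkPolynomial d q).natDegree ≤ 2 * d := by
  refine natDegree_sum_le_of_forall_le _ _ fun k hk => ?_
  have hk' : k ≤ d := by simpa [Nat.lt_succ_iff] using hk
  refine (natDegree_C_mul_le _ _).trans (natDegree_mul_le.trans ?_)
  have h1 : ((X ^ 2 + 1 : ℂ[X]) ^ k).natDegree ≤ k * 2 := by
    refine natDegree_pow_le.trans (Nat.mul_le_mul_left k ?_)
    exact (natDegree_add_le _ _).trans (by simp)
  rw [natDegree_X_pow]
  omega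

/-- The denominators clear because w² + 1 = w(w + w'). A general algebra allows use both at points
of the circle and at the walk operator. -/
lemma aeval_walkPolynomial {𝔸 : Type*} [Ring 𝔸] [Algebra ℂ 𝔸] {d : ℕ} {q : ℂ[X]}
    (hq : q.natDegree ≤ d) {w w' : 𝔸} (h : w * w' = 1) (h' : w' * w = 1) :
    aeval w (walkPolynomial d q) = w ^ d * aeval ((1 / 2 : ℂ) • (w + w')) q := by
  have hcomm : Commute w (w + w') := (Commute.refl w).add_right (by rw [Commute, SemiconjBy, h, h'])
  rw [walkPolynomial, map_sum, aeval_eq_sum_range' (Nat.lt_succ_of_le hq), Finset.mul_sum]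
  refine Finset.sum_congr rfl fun k hk => ?_
  have hk' : k ≤ d := by simpa [Nat.lt_succ_iff] using hk
  have h1 : w ^ 2 + 1 = w * (w + w') := by rw [mul_add, h, sq]
  simp only [map_mul, aeval_C, map_pow, map_add, aeval_X, map_one]
  have h2 : w ^ k * (w + w') ^ k * w ^ (d - k) = w ^ d * (w + w') ^ k := by
    rw [mul_assoc, ((hcomm.pow_pow (d - k) k).eq).symm, ← mul_assoc, ← pow_add,
      Nat.add_sub_cancel' hk']
  rw [h1, hcomm.mul_pow, h2, _root_.smul_pow, ← map_pow, ← map_mul, ← Algebra.smul_def, smul_smul,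
    mul_smul_comm]

/-- E is a fixed point of the cubic. The difference expands into multiples of p - E and its
conjugate, and for |p| ≤ 2 the constant is (3 + 4 + 2 + 1)/2 = 5. -/
lemma norm_sub_le_of_cubic {p E : ℂ} {ε : ℝ} (hE : ‖E‖ = 1) (hp : ‖p‖ ≤ 2) (h : ‖p - E‖ ≤ ε) :
    ‖(1 / 2) * (3 * p - p ^ 2 * starRingEnd ℂ p) - E‖ ≤ 5 * ε := by
  have hEE : E * starRingEnd ℂ E = 1 := by rw [Complex.mul_conj', hE]; simp
  have heq : (1 / 2) * (3 * p - p ^ 2 * starRingEnd ℂ p) - E =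
      (1 / 2) * (3 * (p - E) - ((p - E) * (p * starRingEnd ℂ p) + E * ((p - E) * starRingEnd ℂ p) +
        E * E * starRingEnd ℂ (p - E))) := by
    rw [map_sub]; linear_combination (-E) / 2 * hEE
  have hε : 0 ≤ ε := (norm_nonneg _).trans h
  have h1 : ‖(p - E) * (p * starRingEnd ℂ p)‖ ≤ ε * 4 := by
    rw [norm_mul, norm_mul, RCLike.norm_conj]
    exact mul_le_mul h (by nlinarith [norm_nonneg p]) (by positivity) hε
  have h2 : ‖E * ((p - E) * starRingEnd ℂ p)‖ ≤ ε * 2 := by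
    rw [norm_mul, norm_mul, RCLike.norm_conj, hE, one_mul]
    exact mul_le_mul h hp (by positivity) hε
  have h3 : ‖E * E * starRingEnd ℂ (p - E)‖ ≤ ε := by
    rw [norm_mul, norm_mul, RCLike.norm_conj, hE]; simpa using h
  have h4 : ‖3 * (p - E)‖ ≤ 3 * ε := by rw [norm_mul]; simpa using h
  rw [heq, norm_mul]
  have h5 := norm_sub_le (3 * (p - E)) ((p - E) * (p * starRingEnd ℂ p) +
    E * ((p - E) * starRingEnd ℂ p) + E * E * starRingEnd ℂ (p - E))
  have h6 := norm_add₃_le (a := (p - E) * (p * starRingEnd ℂ p))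
    (b := E * ((p - E) * starRingEnd ℂ p)) (c := E * E * starRingEnd ℂ (p - E))
  have h7 : ‖(1 / 2 : ℂ)‖ = 1 / 2 := by simp
  rw [h7]
  linarith

/-- With r = |p| the two bounds on r(3 - r²)/2 are the factorizations 2 + 3r - r³ = (2 - r)(r + 1)²
and 2 - 3r + r³ = (r + 2)(r - 1)². -/
lemma norm_cubic_le_one {p : ℂ} (hp : ‖p‖ ≤ 2) :
    ‖(1 / 2) * (3 * p - p ^ 2 * starRingEnd ℂ p)‖ ≤ 1 := by
  have heq : (1 / 2) * (3 * p - p ^ 2 * starRingEnd ℂ p) =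
      (((3 - ‖p‖ ^ 2) / 2 : ℝ) : ℂ) * p := by
    push_cast
    rw [← Complex.mul_conj']; ring
  rw [heq, norm_mul, Complex.norm_real, Real.norm_eq_abs, ← abs_of_nonneg (norm_nonneg p),
    ← abs_mul, abs_of_nonneg (norm_nonneg p), abs_le]
  have := norm_nonneg p
  generalize ‖p‖ = r at *
  constructor
  · nlinarith [mul_nonneg (sub_nonneg.2 hp) (sq_nonneg (r + 1))]
  · nlinarith [mul_nonneg (by linarith : 0 ≤ r + 2) (sq_nonneg (r - 1))]

/-- The Taylor polynomial of `exp (-i τ y)` with `K` terms. -/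
noncomputable def expTaylor (K : ℕ) (τ : ℝ) : ℂ[X] :=
  ∑ k ∈ Finset.range K, C ((-(Complex.I * τ)) ^ k / k.factorial) * X ^ k

lemma natDegree_expTaylor_le (K : ℕ) (τ : ℝ) : (expTaylor K τ).natDegree ≤ K :=
  natDegree_sum_le_of_forall_le _ _ fun _ hk => (natDegree_C_mul_X_pow_le _ _).trans
    (Finset.mem_range.1 hk).le

/-- The condition 2x ≤ K makes the remainder at most twice its first term, and K! ≥ (K/3)^K, from e
< 3, turns that term into a pure power. -/
lemma norm_expTaylor_sub_le {K : ℕ} {τ y x : ℝ} (hK : 0 < K) (hx : |τ * y| ≤ x)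
    (hxK : 2 * x ≤ K) :
    ‖(expTaylor K τ).eval (y : ℂ) - Complex.exp (-(Complex.I * τ) * y)‖ ≤
      2 * (3 * x / K) ^ K := by
  have hnorm : ‖-(Complex.I * τ) * (y : ℂ)‖ = |τ * y| := by
    simp [abs_mul]
  have hKr : (0 : ℝ) < K := by exact_mod_cast hK
  have hx0 : 0 ≤ x := (abs_nonneg _).trans hx
  have h := Complex.exp_bound' (x := -(Complex.I * τ) * (y : ℂ)) (n := K) (by
    rw [hnorm, div_le_iff₀ (by positivity)]
    push_cast
    linarith)
  have heval : (expTaylor K τ).eval (y : ℂ) =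
      ∑ m ∈ Finset.range K, (-(Complex.I * τ) * (y : ℂ)) ^ m / m.factorial := by
    rw [expTaylor, eval_finsetSum]
    refine Finset.sum_congr rfl fun k _ => ?_
    simp only [eval_mul, eval_C, eval_pow, eval_X]
    rw [mul_pow _ (y : ℂ)]; ring
  rw [norm_sub_rev, heval]
  refine h.trans ?_
  rw [hnorm, mul_comm]
  refine mul_le_mul_of_nonneg_left ?_ (by norm_num)
  have h1 : (K : ℝ) ^ K / K.factorial ≤ 3 ^ K := by
    refine (Real.pow_div_factorial_le_exp _ hKr.le K).trans ?_
    rw [← mul_one (K : ℝ), Real.exp_nat_mul]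
    exact pow_le_pow_left₀ (Real.exp_nonneg _) (by linarith [Real.exp_one_lt_d9]) _
  have hf : (0 : ℝ) < K.factorial := by exact_mod_cast K.factorial_pos
  calc |τ * y| ^ K / K.factorial ≤ x ^ K / K.factorial := by gcongr
    _ = (x / K) ^ K * ((K : ℝ) ^ K / K.factorial) := by rw [div_pow]; field_simp
    _ ≤ (x / K) ^ K * 3 ^ K := by gcongr
    _ = (3 * x / K) ^ K := by rw [← mul_pow]; ring

/-- A polynomial that is a strict contraction on `[-1, 1]`, and that is close to `exp (-i τ y)`
where `|τ y|` is small compared with its degree. -/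
lemma exists_evolution_polynomial {K : ℕ} {τ x δ : ℝ} (hτ : 0 ≤ τ) (hδ : 0 < δ) (hδ1 : δ ≤ 1)
    (hx : 0 ≤ x) (hK3 : 3 ≤ K) (hKτ : 6 * τ ≤ K) (hKx : 12 * x ≤ K * Real.sqrt δ) :
    ∃ q : ℂ[X], q.natDegree ≤ 3 * K ∧ (∀ y : ℝ, |y| ≤ 1 → ‖q.eval (y : ℂ)‖ < 1) ∧
      ∀ y : ℝ, |τ * y| ≤ x →
        ‖q.eval (y : ℂ) - Complex.exp (-(Complex.I * τ) * y)‖ ≤ 3 / 10 * δ := by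
  have hKr : (3 : ℝ) ≤ K := by exact_mod_cast hK3
  have hK0 : (0 : ℝ) < K := by linarith
  set p := expTaylor K τ with hp
  -- At real points conjugation of p only conjugates its coefficients, so the cubic in p and its
  -- conjugate is again a polynomial, of degree at most 3K.
  have hconj : ∀ y : ℝ, (p.map (starRingEnd ℂ)).eval (y : ℂ) = starRingEnd ℂ (p.eval (y : ℂ)) := by
    intro y
    rw [eval_map, ← eval₂_hom, Complex.conj_ofReal]
  set g : ℂ[X] := C (1 / 2) * (3 * p - p ^ 2 * p.map (starRingEnd ℂ)) with hg
  have hgeval : ∀ y : ℝ, g.eval (y : ℂ) =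
      (1 / 2) * (3 * p.eval (y : ℂ) - p.eval (y : ℂ) ^ 2 * starRingEnd ℂ (p.eval (y : ℂ))) := by
    intro y
    rw [← hconj]
    simp [hg]
  have hqeval : ∀ y : ℝ, (C ((1 - δ / 10 : ℝ) : ℂ) * g).eval (y : ℂ) =
      ((1 - δ / 10 : ℝ) : ℂ) * g.eval (y : ℂ) := fun y => by simp
  have hE : ∀ y : ℝ, ‖Complex.exp (-(Complex.I * τ) * y)‖ = 1 := fun y => by
    rw [Complex.norm_exp]; simp
  have hp2 : ∀ y : ℝ, ∀ ε : ℝ, ε ≤ 1 →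
      ‖p.eval (y : ℂ) - Complex.exp (-(Complex.I * τ) * y)‖ ≤ ε → ‖p.eval (y : ℂ)‖ ≤ 2 := by
    intro y ε hε h
    have := norm_sub_norm_le (p.eval (y : ℂ)) (Complex.exp (-(Complex.I * τ) * y))
    rw [hE] at this
    linarith
  have hη : ‖((1 - δ / 10 : ℝ) : ℂ)‖ = 1 - δ / 10 := by
    rw [Complex.norm_real, Real.norm_eq_abs, abs_of_nonneg (by linarith)]
  -- The factor 1 - δ/10 makes the bound by one strict, as Fejér–Riesz requires.
  refine ⟨C ((1 - δ / 10 : ℝ) : ℂ) * g, ?_, fun y hy => ?_, fun y hy => ?_⟩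
  · have hpd : p.natDegree ≤ K := natDegree_expTaylor_le K τ
    have hpd' : (p.map (starRingEnd ℂ)).natDegree ≤ K := natDegree_map_le.trans hpd
    refine (natDegree_C_mul_le _ _).trans ((natDegree_C_mul_le _ _).trans
      ((natDegree_sub_le _ _).trans (max_le ?_ ?_)))
    · refine natDegree_mul_le.trans ?_
      have : (3 : ℂ[X]).natDegree = 0 := natDegree_ofNat 3
      omega
    · refine natDegree_mul_le.trans ?_
      have := natDegree_pow_le (p := p) (n := 2)
      omega
  · have h1 := norm_expTaylor_sub_le (K := K) (τ := τ) (y := y) (x := τ) (by omega)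
      (by rw [abs_mul, abs_of_nonneg hτ]; nlinarith [abs_nonneg y]) (by linarith)
    have h2 : 2 * (3 * τ / K) ^ K ≤ (1 : ℝ) := by
      have h3 : 3 * τ / K ≤ 1 / 2 := by rw [div_le_iff₀ hK0]; linarith
      have h4 : (3 * τ / K) ^ K ≤ 3 * τ / K :=
        pow_le_of_le_one (by positivity) (by linarith) (by omega)
      linarith
    have h3 := norm_cubic_le_one (hp2 y _ h2 h1)
    rw [hqeval, norm_mul, hη, hgeval]
    nlinarith [norm_nonneg ((1 / 2) *
      (3 * p.eval (y : ℂ) - p.eval (y : ℂ) ^ 2 * starRingEnd ℂ (p.eval (y : ℂ))))]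
  · have hs : Real.sqrt δ ≤ 1 := Real.sqrt_le_one.2 hδ1
    have hs0 := Real.sqrt_nonneg δ
    have h1 := norm_expTaylor_sub_le (K := K) (τ := τ) (y := y) (x := x) (by omega) hy
      (by nlinarith)
    -- Of K ≥ 3 factors, two give δ/16 and a third gives 1/4.
    have h2 : 2 * (3 * x / K) ^ K ≤ δ / 32 := by
      have h3 : 3 * x / K ≤ Real.sqrt δ / 4 := by rw [div_le_iff₀ hK0]; linarith
      have h4 : 3 * x / K ≤ 1 / 4 := by linarith
      have h0 : 0 ≤ 3 * x / K := by positivity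
      have h5 : (3 * x / K) ^ K ≤ (3 * x / K) ^ 3 := pow_le_pow_of_le_one h0 (by linarith) hK3
      have h6 : (3 * x / K) ^ 2 ≤ δ / 16 := by
        refine (pow_le_pow_left₀ h0 h3 2).trans (le_of_eq ?_)
        rw [div_pow, Real.sq_sqrt hδ.le]; norm_num
      have h7 : (3 * x / K) ^ 3 ≤ δ / 16 * (1 / 4) := by
        rw [pow_succ]
        exact mul_le_mul h6 h4 h0 (by positivity)
      linarith
    have h1' := h1.trans h2
    have hpn := hp2 y _ (by linarith) h1'
    have h3 := norm_sub_le_of_cubic (hE y) hpn h1'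
    have h4 := norm_cubic_le_one hpn
    rw [← hgeval] at h3 h4
    have heq : ((1 - δ / 10 : ℝ) : ℂ) * g.eval (y : ℂ) - Complex.exp (-(Complex.I * τ) * y) =
        (g.eval (y : ℂ) - Complex.exp (-(Complex.I * τ) * y)) -
          ((δ / 10 : ℝ) : ℂ) * g.eval (y : ℂ) := by
      push_cast; ring
    rw [hqeval, heq]
    -- The cubic contributes 5δ/32 and the damping δ/10, together below 3δ/10.
    refine (norm_sub_le _ _).trans ?_
    rw [norm_mul, Complex.norm_real, Real.norm_eq_abs, abs_of_nonneg (by linarith)]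
    nlinarith

lemma norm_eval_walkPolynomial_lt {d : ℕ} {q : ℂ[X]} (hq : q.natDegree ≤ d)
    (h : ∀ y : ℝ, |y| ≤ 1 → ‖q.eval (y : ℂ)‖ < 1) {z : ℂ} (hz : ‖z‖ = 1) :
    ‖(walkPolynomial d q).eval z‖ < 1 := by
  have h1 : z * starRingEnd ℂ z = 1 := by rw [Complex.mul_conj', hz]; simp
  have h2 := aeval_walkPolynomial hq h1 (by rw [mul_comm]; exact h1)
  have h3 : (1 / 2 : ℂ) • (z + starRingEnd ℂ z) = ((z.re : ℝ) : ℂ) := by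
    rw [Complex.add_conj, smul_eq_mul]; push_cast; ring
  rw [h3, coe_aeval_eq_eval, coe_aeval_eq_eval] at h2
  rw [h2, norm_mul, norm_pow, hz, one_pow, one_mul]
  exact h _ ((Complex.abs_re_le_norm z).trans hz.le)

end Approximation

/-! ### Functional calculus, perturbation of the evolution, and the Schur test -/

section OperatorNorm

open scoped Matrix.Norms.L2Operator
open Matrix

variable {n m : Type*} [Fintype n] [DecidableEq n] [Fintype m] [DecidableEq m]

/-- By the functional calculus the norm is controlled by the values on the spectrum, which is real
and bounded by ‖A‖. Hence q need not be accurate on the rest of [-1, 1]. -/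
lemma norm_aeval_sub_exp_le {A : Matrix n n ℂ} (hA : A.IsHermitian) {q : Polynomial ℂ}
    {τ x κ : ℝ} (hτ : 0 ≤ τ) (hx : τ * ‖A‖ ≤ x) (hκ : 0 ≤ κ)
    (hq : ∀ y : ℝ, |τ * y| ≤ x →
      ‖q.eval (y : ℂ) - Complex.exp (-(Complex.I * τ) * y)‖ ≤ κ) :
    ‖Polynomial.aeval A q - NormedSpace.exp ((-(Complex.I * (τ : ℂ))) • A)‖ ≤ κ := by
  have hsa : IsSelfAdjoint A := hA
  have hn : IsStarNormal A := hsa.isStarNormal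
  have hexp : NormedSpace.exp ((-(Complex.I * (τ : ℂ))) • A) =
      cfc (fun z : ℂ => Complex.exp (-(Complex.I * τ) * z)) A := by
    have hn' : IsStarNormal ((-(Complex.I * (τ : ℂ))) • A) := hn.smul _
    rw [← CFC.complex_exp_eq_normedSpace_exp (a := (-(Complex.I * (τ : ℂ))) • A)]
    rw [← cfc_comp_smul (-(Complex.I * (τ : ℂ))) Complex.exp A]
    simp
  rw [hexp, ← cfc_polynomial q A, ← cfc_sub _ _ A]
  refine norm_cfc_le hκ fun z hz => ?_
  have hre : z = (z.re : ℂ) := hsa.mem_spectrum_eq_re hz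
  rw [hre]
  refine hq _ ?_
  rw [abs_mul, abs_of_nonneg hτ]
  refine (mul_le_mul_of_nonneg_left ?_ hτ).trans hx
  have : Nontrivial (Matrix n n ℂ) := by
    by_contra h
    rw [not_nontrivial_iff_subsingleton] at h
    rw [spectrum.of_subsingleton] at hz
    exact hz
  exact (Complex.abs_re_le_norm z).trans (spectrum.norm_le_norm_of_mem hz)

lemma conjTranspose_evolution {M : ℕ} {H : Matrix (Fin M) (Fin M) ℂ} (hH : H.IsHermitian)
    (t : ℝ) : (evolution H t)ᴴ = evolution H (-t) := by
  rw [evolution, evolution, ← Matrix.exp_conjTranspose, conjTranspose_smul, hH.eq]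
  simp

lemma evolution_mul_neg {M : ℕ} (H : Matrix (Fin M) (Fin M) ℂ) (t : ℝ) :
    evolution H t * evolution H (-t) = 1 := by
  have h : (-(Complex.I * ((-t : ℝ) : ℂ))) • H = -((-(Complex.I * (t : ℂ))) • H) := by
    rw [← neg_smul]; push_cast; ring_nf
  rw [evolution, evolution, h, ← Matrix.exp_add_of_commute _ _ (Commute.refl ((-(Complex.I * (t : ℂ))) • H)).neg_right,
    add_neg_cancel, NormedSpace.exp_zero]

lemma evolution_mem_unitaryGroup {M : ℕ} {H : Matrix (Fin M) (Fin M) ℂ} (hH : H.IsHermitian)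
    (t : ℝ) : evolution H t ∈ unitaryGroup (Fin M) ℂ := by
  rw [mem_unitaryGroup_iff, star_eq_conjTranspose, conjTranspose_evolution hH, evolution_mul_neg]

lemma norm_le_one_of_unitary {U : Matrix n n ℂ} (hU : U ∈ unitaryGroup n ℂ) : ‖U‖ ≤ 1 := by
  cases isEmpty_or_nonempty n
  · have : U = 0 := by ext i; exact isEmptyElim i
    simp [this]
  · exact (CStarRing.norm_of_mem_unitary hU).le

/-- Duhamel's argument: the derivative of e^{iHs} e^{-iH's} is i e^{iHs} (H - H') e^{-iH's}, whose
norm is at most ‖H - H'‖ by unitarity. -/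
lemma norm_evolution_sub_le {M : ℕ} {H H' : Matrix (Fin M) (Fin M) ℂ} (hH : H.IsHermitian)
    (hH' : H'.IsHermitian) {t : ℝ} (ht : 0 ≤ t) :
    ‖evolution H t - evolution H' t‖ ≤ t * ‖H - H'‖ := by
  have hderiv : ∀ (G : Matrix (Fin M) (Fin M) ℂ) (s : ℝ),
      HasDerivAt (evolution G) ((-Complex.I) • (G * evolution G s)) s := by
    intro G s
    have h := hasDerivAt_exp_smul_const' (𝕂 := ℝ) ((-Complex.I) • G) s
    have h1 : (fun u : ℝ => NormedSpace.exp (u • ((-Complex.I) • G))) = evolution G := by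
      funext u
      rw [evolution, ← Complex.coe_smul, smul_smul]; ring_nf
    have h2 : NormedSpace.exp (s • ((-Complex.I) • G)) = evolution G s := congrFun h1 s
    rw [h2] at h
    rw [h1, smul_mul_assoc] at h
    exact h
  have hneg : ∀ (s : ℝ), HasDerivAt (fun u => evolution H (-u))
      ((Complex.I) • (evolution H (-s) * H)) s := by
    intro s
    have h := hasDerivAt_exp_smul_const (𝕂 := ℝ) ((Complex.I) • H) s
    have h1 : (fun u : ℝ => NormedSpace.exp (u • ((Complex.I) • H))) =
        fun u => evolution H (-u) := by
      funext u
      rw [evolution, ← Complex.coe_smul, smul_smul]; push_cast; ring_nf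
    have h2 : NormedSpace.exp (s • ((Complex.I) • H)) = evolution H (-s) := congrFun h1 s
    rw [h2] at h
    rw [h1, mul_smul_comm] at h
    exact h
  have hunit : ∀ {G : Matrix (Fin M) (Fin M) ℂ}, G.IsHermitian → ∀ s, ‖evolution G s‖ ≤ 1 :=
    fun hG s => norm_le_one_of_unitary (evolution_mem_unitaryGroup hG s)
  have hbound := norm_image_sub_le_of_norm_deriv_le_segment' (a := 0) (b := t) (C := ‖H - H'‖)
    (f := fun s => evolution H (-s) * evolution H' s)
    (f' := fun s => Complex.I • (evolution H (-s) * (H - H') * evolution H' s))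
    (fun s _ => by
      have h := ((hneg s).mul (hderiv H' s)).hasDerivWithinAt (s := Set.Icc 0 t)
      refine h.congr_deriv ?_
      rw [smul_mul_assoc, mul_smul_comm, neg_smul, ← sub_eq_add_neg, ← smul_sub,
        mul_sub, sub_mul]
      simp only [mul_assoc])
    (fun s _ => by
      rw [norm_smul, Complex.norm_I, one_mul]
      refine (norm_mul_le _ _).trans ((mul_le_of_le_one_right (norm_nonneg _) (hunit hH' s)).trans
        ((norm_mul_le _ _).trans (mul_le_of_le_one_left (norm_nonneg _) (hunit hH _)))))
    t ⟨ht, le_rfl⟩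
  have h0 : evolution H (-0) * evolution H' 0 = 1 := by simp [evolution]
  simp only [h0, sub_zero] at hbound
  have heq : evolution H t - evolution H' t =
      -(evolution H t * (evolution H (-t) * evolution H' t - 1)) := by
    rw [mul_sub, ← mul_assoc, evolution_mul_neg]; simp
  rw [heq, norm_neg, mul_comm t]
  exact (norm_mul_le _ _).trans ((mul_le_of_le_one_left (norm_nonneg _) (hunit hH t)).trans hbound)

/-- The Schur test for Hermitian matrices. -/
lemma norm_le_of_row_sum_le {A : Matrix n n ℂ} (hA : A.IsHermitian) {r : ℝ} (hr : 0 ≤ r)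
    (h : ∀ i, ∑ j, ‖A i j‖ ≤ r) : ‖A‖ ≤ r := by
  have hsa : IsSelfAdjoint A := hA
  have hn : IsStarNormal A := hsa.isStarNormal
  rw [← cfc_id ℂ A]
  refine norm_cfc_le hr fun z hz => ?_
  rw [← spectrum_toLin', ← Module.End.hasEigenvalue_iff_mem_spectrum] at hz
  obtain ⟨v, hv⟩ := hz.exists_hasEigenvector
  have hvA : A *ᵥ v = z • v := by simpa using hv.apply_eq_smul
  have hv0 := hv.2
  obtain ⟨i, hi⟩ : ∃ i, v i ≠ 0 := Function.ne_iff.1 hv0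
  -- For a Hermitian matrix it suffices to bound eigenvalues; the eigenvalue equation is read off in
  -- the row where the eigenvector is largest.
  obtain ⟨k, _, hk⟩ := Finset.exists_max_image Finset.univ (fun i => ‖v i‖) ⟨i, Finset.mem_univ i⟩
  have hk0 : 0 < ‖v k‖ := (norm_pos_iff.2 hi).trans_le (hk i (Finset.mem_univ i))
  have h1 : z * v k = ∑ j, A k j * v j := by
    have := congrFun hvA k
    simpa [mulVec, dotProduct] using this.symm
  refine le_of_mul_le_mul_right ?_ hk0
  rw [id, ← norm_mul, h1]
  calc ‖∑ j, A k j * v j‖ ≤ ∑ j, ‖A k j‖ * ‖v k‖ := by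
        refine (norm_sum_le _ _).trans (Finset.sum_le_sum fun j hj => ?_)
        rw [norm_mul]
        exact mul_le_mul_of_nonneg_left (hk j hj) (norm_nonneg _)
    _ ≤ r * ‖v k‖ := by
        rw [← Finset.sum_mul]
        exact mul_le_mul_of_nonneg_right (h k) hk0.le

end OperatorNorm

/-! ### Trace norm duality and discarding ancillas -/

section TraceNorm

open scoped Matrix.Norms.L2Operator
open Matrix

variable {n m : Type*} [Fintype n] [DecidableEq n] [Fintype m] [DecidableEq m]

lemma norm_apply_le_l2_opNorm (A : Matrix n n ℂ) (i j : n) : ‖A i j‖ ≤ ‖A‖ := by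
  have h := l2_opNorm_mulVec A (EuclideanSpace.single j (1 : ℂ))
  rw [EuclideanSpace.single, PiLp.norm_single, norm_one, mul_one] at h
  refine le_trans ?_ h
  have h2 := PiLp.norm_apply_le ((EuclideanSpace.equiv n ℂ).symm
    (A *ᵥ (EuclideanSpace.single j (1 : ℂ)).ofLp)) i
  simpa [EuclideanSpace.single] using h2

/-- In an eigenbasis of ρ the trace is a sum of diagonal entries of a conjugate of Z, weighted by
the nonnegative eigenvalues of ρ. -/
lemma norm_trace_mul_le {ρ : Matrix n n ℂ} (hρ : ρ.PosSemidef) (Z : Matrix n n ℂ) :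
    ‖(ρ * Z).trace‖ ≤ ‖Z‖ * ρ.trace.re := by
  have hs := hρ.isHermitian.spectral_theorem
  rw [Unitary.conjStarAlgAut_apply] at hs
  set U := hρ.isHermitian.eigenvectorUnitary
  set e := hρ.isHermitian.eigenvalues with he
  have hU : ‖(U : Matrix n n ℂ)‖ ≤ 1 := norm_le_one_of_unitary U.2
  have hU' : ‖star (U : Matrix n n ℂ)‖ ≤ 1 := by rw [norm_star]; exact hU
  have h1 : (ρ * Z).trace = ∑ i, (e i : ℂ) * (star (U : Matrix n n ℂ) * Z * U) i i := by
    rw [hs]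
    calc _ = ((diagonal (RCLike.ofReal ∘ e)) * (star (U : Matrix n n ℂ) * Z * (U : Matrix n n ℂ))).trace := by
          rw [mul_assoc, mul_assoc, trace_mul_comm]; simp only [mul_assoc]
      _ = _ := by simp only [trace, diag_apply, diagonal_mul, Function.comp_apply]; rfl
  have h2 : ρ.trace.re = ∑ i, e i := by
    rw [hρ.isHermitian.trace_eq_sum_eigenvalues]
    simp [he]
  rw [h1, h2, Finset.mul_sum]
  refine (norm_sum_le _ _).trans (Finset.sum_le_sum fun i _ => ?_)
  have h0 : 0 ≤ e i := hρ.eigenvalues_nonneg i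
  rw [norm_mul, Complex.norm_real, Real.norm_eq_abs, abs_of_nonneg h0, mul_comm]
  refine mul_le_mul_of_nonneg_right ?_ h0
  refine (norm_apply_le_l2_opNorm _ i i).trans ?_
  refine (norm_mul_le _ _).trans ((mul_le_of_le_one_right (norm_nonneg _) hU).trans
    ((norm_mul_le _ _).trans (mul_le_of_le_one_left (norm_nonneg _) hU')))

/-- Polar decomposition: S is the pseudo-inverse of |X| times Xᴴ, so S X = |X|, and S Sᴴ is the
projection onto the support of |X|. -/
lemma exists_contraction_trace_eq_traceNorm (X : Matrix n n ℂ) :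
    ∃ S : Matrix n n ℂ, ‖S‖ ≤ 1 ∧ (S * X).trace = traceNorm X := by
  have hX := isHermitian_conjTranspose_mul_self X
  have hs := hX.spectral_theorem
  rw [Unitary.conjStarAlgAut_apply] at hs
  have hUm := hX.eigenvectorUnitary.2
  have h0 : ∀ i, 0 ≤ hX.eigenvalues i := (posSemidef_conjTranspose_mul_self X).eigenvalues_nonneg
  have htn : traceNorm X = ∑ i, Real.sqrt (hX.eigenvalues i) := rfl
  rw [htn]
  generalize hX.eigenvalues = e at *
  generalize (hX.eigenvectorUnitary : Matrix n n ℂ) = U at *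
  -- The convention 0⁻¹ = 0 makes this the pseudo-inverse without case distinctions.
  set g : Matrix n n ℂ := diagonal fun i => (((Real.sqrt (e i))⁻¹ : ℝ) : ℂ) with hg
  have hUU : star U * U = 1 := mem_unitaryGroup_iff'.1 hUm
  have hgs : star g = g := by
    rw [hg, star_eq_conjTranspose, diagonal_conjTranspose]
    congr 1; funext i; simp
  refine ⟨U * g * star U * Xᴴ, ?_, ?_⟩
  · set S := U * g * star U * Xᴴ with hS
    have h1 : S * star S = U * (g * diagonal (RCLike.ofReal ∘ e) * g) * star U := by
      rw [hS]
      simp only [star_mul, star_star, hgs, ← star_eq_conjTranspose X]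
      calc _ = U * g * star U * (star X * X) * (U * (g * star U)) := by
            simp only [mul_assoc]
        _ = U * g * (star U * U) * diagonal (RCLike.ofReal ∘ e) *
            (star U * U) * g * star U := by
            rw [star_eq_conjTranspose X, hs]; simp only [mul_assoc]
        _ = _ := by rw [hUU]; simp only [mul_assoc, mul_one]
    have h2 : ‖g * diagonal (RCLike.ofReal ∘ e) * g‖ ≤ 1 := by
      rw [hg, diagonal_mul_diagonal, diagonal_mul_diagonal, l2_opNorm_diagonal,
        pi_norm_le_iff_of_nonneg zero_le_one]
      intro i
      simp only [Function.comp_apply, norm_mul, Complex.norm_real,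
        Real.norm_eq_abs, abs_inv, abs_of_nonneg (Real.sqrt_nonneg _), Complex.coe_algebraMap,
        abs_of_nonneg (h0 i)]
      rcases (h0 i).eq_or_lt with h | h
      · simp [← h]
      · have h3 := Real.sqrt_pos.2 h
        have h4 := Real.mul_self_sqrt (h0 i)
        rw [mul_right_comm, ← mul_inv, h4, inv_mul_cancel₀ h.ne']
    have hU : ‖U‖ ≤ 1 := norm_le_one_of_unitary hUm
    have hU' : ‖star U‖ ≤ 1 := by rw [norm_star]; exact hU
    have h3 : ‖S‖ * ‖S‖ ≤ 1 := by
      rw [← CStarRing.norm_self_mul_star, h1]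
      exact (norm_mul_le _ _).trans ((mul_le_of_le_one_right (norm_nonneg _) hU').trans
        ((norm_mul_le _ _).trans ((mul_le_of_le_one_left (norm_nonneg _) hU).trans h2)))
    nlinarith [norm_nonneg S]
  · rw [mul_assoc, hs]
    calc _ = (U * (g * (star U * U) * diagonal (RCLike.ofReal ∘ e) *
            star U)).trace := by simp only [mul_assoc]
      _ = (g * (star U * U) * diagonal (RCLike.ofReal ∘ e) *
            (star U * U)).trace := by
          rw [trace_mul_comm]; simp only [mul_assoc]
      _ = _ := by
          rw [hUU, mul_one, mul_one, hg, diagonal_mul_diagonal, trace_diagonal, Complex.ofReal_sum]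
          refine Finset.sum_congr rfl fun i _ => ?_
          simp only [Function.comp_apply, Complex.coe_algebraMap]
          have h4 := Real.mul_self_sqrt (h0 i)
          rcases (h0 i).eq_or_lt with h | h
          · simp [← h]
          · have h3 := Real.sqrt_pos.2 h
            nth_rewrite 2 [← h4]
            push_cast
            have h5 : ((Real.sqrt (e i) : ℝ) : ℂ) ≠ 0 := by exact_mod_cast h3.ne'
            rw [← mul_assoc, inv_mul_cancel₀ h5, one_mul]

/-- The inclusion that appends an ancilla in the basis state `s`. -/
def embedAt (s : n) : Matrix (m × n) m ℂ := (1 : Matrix (m × n) (m × n) ℂ).submatrix id (·, s)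

lemma embedAt_conjTranspose_mul_mul (G : Matrix (m × n) (m × n) ℂ) (s : n) :
    (embedAt (m := m) s)ᴴ * G * embedAt (m := m) s =
      G.submatrix (fun i => (i, s)) (fun i => (i, s)) := by
  ext i j
  simp [embedAt, mul_apply, one_apply]

lemma embedAt_conjTranspose_mul_self (s : n) :
    (embedAt (m := m) s)ᴴ * embedAt (m := m) s = 1 := by
  have h := embedAt_conjTranspose_mul_mul (1 : Matrix (m × n) (m × n) ℂ) s
  rw [Matrix.mul_one] at h
  rw [h]
  ext i j
  simp [one_apply]

lemma norm_embedAt_le (s : n) : ‖embedAt (m := m) s‖ ≤ 1 := by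
  have h := l2_opNorm_conjTranspose_mul_self (embedAt (m := m) s)
  have h1 := norm_le_one_of_unitary (one_mem (unitaryGroup m ℂ))
  rw [embedAt_conjTranspose_mul_self] at h
  nlinarith [norm_nonneg (embedAt (m := m) s)]

omit [DecidableEq m] in
-- The Kraus form of the channel, with one Kraus operator for each final ancilla state.
lemma traceOutRight_conj_single (G : Matrix (m × n) (m × n) ℂ) (s : n) (ρ : Matrix m m ℂ) :
    traceOutRight (G * (ρ ⊗ₖ Matrix.single s s (1 : ℂ)) * Gᴴ) =
      ∑ a, G.submatrix (fun i => (i, a)) (fun j => (j, s)) * ρ *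
        (G.submatrix (fun i => (i, a)) (fun j => (j, s)))ᴴ := by
  ext i i'
  rw [Matrix.sum_apply]
  simp only [traceOutRight, of_apply]
  refine Finset.sum_congr rfl fun a _ => ?_
  simp only [mul_apply, Fintype.sum_prod_type, kroneckerMap_apply, single_apply,
    conjTranspose_apply, submatrix_apply]
  refine Finset.sum_congr rfl fun j _ => ?_
  rw [Finset.sum_eq_single s]
  · congr 1
    refine Finset.sum_congr rfl fun k _ => ?_
    rw [Finset.sum_eq_single s] <;> simp +contextual [eq_comm]
  · intro b _ hb
    simp [hb.symm]
  · simp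

lemma sum_conjTranspose_mul_submatrix {G : Matrix (m × n) (m × n) ℂ}
    (hG : G ∈ unitaryGroup (m × n) ℂ) (s : n) :
    ∑ a, (G.submatrix (fun i => (i, a)) (fun j => (j, s)))ᴴ *
      G.submatrix (fun i => (i, a)) (fun j : m => (j, s)) = 1 := by
  ext i j
  have h := congrFun (congrFun (mem_unitaryGroup_iff'.1 hG) (i, s)) (j, s)
  rw [mul_apply, Fintype.sum_prod_type_right] at h
  rw [Matrix.sum_apply]
  simp only [mul_apply, conjTranspose_apply, submatrix_apply]
  rw [star_eq_conjTranspose] at h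
  simp only [conjTranspose_apply] at h
  rw [h, one_apply, one_apply]
  simp

/-- The Kraus operator of outcome s is κ-close to E, which costs 2κ in trace norm. The other
outcomes carry the missing probability, again at most 2κ. The factor 1/2 of the trace distance
leaves 2κ. -/
lemma traceDist_traceOutRight_le {G : Matrix (m × n) (m × n) ℂ}
    (hG : G ∈ unitaryGroup (m × n) ℂ) {s : n} {E ρ : Matrix m m ℂ} (hE : E ∈ unitaryGroup m ℂ)
    (hρ : IsDensity ρ) {κ : ℝ}
    (hκ : ‖G.submatrix (fun i => (i, s)) (fun j => (j, s)) - E‖ ≤ κ) :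
    traceDist (traceOutRight (G * (ρ ⊗ₖ Matrix.single s s (1 : ℂ)) * Gᴴ)) (E * ρ * Eᴴ) ≤
      2 * κ := by
  rw [traceOutRight_conj_single]
  have hsum := sum_conjTranspose_mul_submatrix hG s
  set B : n → Matrix m m ℂ := fun a => G.submatrix (fun i => (i, a)) (fun j => (j, s)) with hB
  change ‖B s - E‖ ≤ κ at hκ
  change ∑ a, (B a)ᴴ * B a = 1 at hsum
  change traceDist (∑ a, B a * ρ * (B a)ᴴ) _ ≤ _
  have hE1 : ‖E‖ ≤ 1 := norm_le_one_of_unitary hE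
  have hρ1 : ρ.trace.re = 1 := by rw [hρ.2]; simp
  have hEE : Eᴴ * E = 1 := mem_unitaryGroup_iff'.1 hE
  have hκ0 : 0 ≤ κ := (norm_nonneg _).trans hκ
  have hBs : ‖B s‖ ≤ 1 := by
    have h1 : B s = (embedAt (m := m) s)ᴴ * G * embedAt (m := m) s := (embedAt_conjTranspose_mul_mul G s).symm
    have h2 := norm_embedAt_le (m := m) s
    rw [h1]
    refine (l2_opNorm_mul _ _).trans (mul_le_one₀ ((l2_opNorm_mul _ _).trans (mul_le_one₀ ?_
      (norm_nonneg _) (norm_le_one_of_unitary hG))) (norm_nonneg _) h2)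
    rw [l2_opNorm_conjTranspose]; exact h2
  have htrace : ∀ Z : Matrix m m ℂ, ‖(ρ * Z).trace‖ ≤ ‖Z‖ := fun Z => by
    simpa [hρ1] using norm_trace_mul_le hρ.1 Z
  obtain ⟨S, hS, hSX⟩ := exists_contraction_trace_eq_traceNorm
    (∑ a, B a * ρ * (B a)ᴴ - E * ρ * Eᴴ)
  have hdecomp : ∑ a, B a * ρ * (B a)ᴴ - E * ρ * Eᴴ =
      (B s - E) * ρ * (B s)ᴴ + E * ρ * (B s - E)ᴴ +
        ∑ a ∈ Finset.univ.erase s, B a * ρ * (B a)ᴴ := by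
    rw [← Finset.add_sum_erase _ _ (Finset.mem_univ s), conjTranspose_sub]
    noncomm_ring
  have h1 : ‖(S * ((B s - E) * ρ * (B s)ᴴ)).trace‖ ≤ κ := by
    have : (S * ((B s - E) * ρ * (B s)ᴴ)).trace = (ρ * ((B s)ᴴ * S * (B s - E))).trace := by
      rw [← mul_assoc, ← mul_assoc, trace_mul_comm, mul_assoc _ _ ρ, mul_assoc, trace_mul_comm ρ]
      simp only [mul_assoc]
    rw [this]
    refine (htrace _).trans ((norm_mul_le _ _).trans ?_)
    refine (mul_le_of_le_one_left (norm_nonneg _) ?_).trans hκ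
    refine (norm_mul_le _ _).trans (mul_le_one₀ ?_ (norm_nonneg _) hS)
    rw [l2_opNorm_conjTranspose]; exact hBs
  have h2 : ‖(S * (E * ρ * (B s - E)ᴴ)).trace‖ ≤ κ := by
    have : (S * (E * ρ * (B s - E)ᴴ)).trace = (ρ * ((B s - E)ᴴ * S * E)).trace := by
      rw [← mul_assoc, ← mul_assoc, trace_mul_comm, trace_mul_comm ρ]
      simp only [mul_assoc]
    rw [this]
    refine (htrace _).trans ((norm_mul_le _ _).trans ?_)
    refine (mul_le_of_le_one_right (norm_nonneg _) hE1).trans ((norm_mul_le _ _).trans ?_)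
    refine (mul_le_of_le_one_right (norm_nonneg _) hS).trans ?_
    rw [l2_opNorm_conjTranspose]; exact hκ
  have h3 : ‖(S * ∑ a ∈ Finset.univ.erase s, B a * ρ * (B a)ᴴ).trace‖ ≤ 2 * κ := by
    have hpos : (∑ a ∈ Finset.univ.erase s, B a * ρ * (B a)ᴴ).PosSemidef :=
      posSemidef_sum _ fun a _ => hρ.1.mul_mul_conjTranspose_same (B a)
    rw [trace_mul_comm]
    refine (norm_trace_mul_le hpos S).trans ((mul_le_of_le_one_left ?_ hS).trans ?_)
    · exact (Complex.le_def.1 hpos.trace_nonneg).1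
    · have h4 : (∑ a ∈ Finset.univ.erase s, B a * ρ * (B a)ᴴ).trace =
          (ρ * (1 - (B s)ᴴ * B s)).trace := by
        rw [← hsum, ← Finset.add_sum_erase _ _ (Finset.mem_univ s), add_sub_cancel_left,
          Finset.mul_sum, trace_sum, trace_sum]
        refine Finset.sum_congr rfl fun a _ => ?_
        rw [trace_mul_comm, ← mul_assoc, trace_mul_comm]
      rw [h4]
      refine (Complex.re_le_norm _).trans ((htrace _).trans ?_)
      -- Unitarity of E shows that the missing weight is of first order in B s - E.
      have h5 : 1 - (B s)ᴴ * B s = -(Eᴴ * (B s - E)) - (B s - E)ᴴ * B s := by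
        rw [← hEE, conjTranspose_sub]; noncomm_ring
      rw [h5]
      refine (norm_sub_le _ _).trans ?_
      rw [norm_neg, two_mul]
      refine add_le_add ?_ ?_
      · refine (norm_mul_le _ _).trans ((mul_le_of_le_one_left (norm_nonneg _) ?_).trans hκ)
        rw [l2_opNorm_conjTranspose]; exact hE1
      · refine (norm_mul_le _ _).trans ((mul_le_of_le_one_right (norm_nonneg _) hBs).trans ?_)
        rw [l2_opNorm_conjTranspose]; exact hκ
  have h4 : traceNorm (∑ a, B a * ρ * (B a)ᴴ - E * ρ * Eᴴ) ≤ 4 * κ := by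
    refine (le_abs_self _).trans ?_
    rw [← Real.norm_eq_abs, ← Complex.norm_real, ← hSX, hdecomp, mul_add, mul_add, trace_add,
      trace_add]
    refine (norm_add₃_le).trans ?_
    linarith
  rw [traceDist]
  linarith

end TraceNorm

/-! ### Query circuits for polynomials of an encoded matrix -/

section Circuits

open Matrix

/-! ### Quantum walks from Hermitian unitaries -/

section Walk

variable {n m : Type*} [Fintype n] [DecidableEq n] [Fintype m] [DecidableEq m]

/-- The reflection about the range of an isometry. -/
def reflection (V : Matrix n m ℂ) : Matrix n n ℂ := 2 • (V * Vᴴ) - 1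

lemma reflection_mul_self {V : Matrix n m ℂ} (hV : Vᴴ * V = 1) :
    reflection V * reflection V = 1 := by
  have h : V * Vᴴ * (V * Vᴴ) = V * Vᴴ := by
    rw [Matrix.mul_assoc, ← Matrix.mul_assoc Vᴴ, hV, Matrix.one_mul]
  rw [reflection]
  simp only [two_smul]
  noncomm_ring
  rw [h]
  abel

omit [Fintype n] [DecidableEq m] in
lemma reflection_conjTranspose (V : Matrix n m ℂ) : (reflection V)ᴴ = reflection V := by
  simp [reflection, two_smul]

lemma reflection_mem_unitaryGroup {V : Matrix n m ℂ} (hV : Vᴴ * V = 1) :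
    reflection V ∈ unitaryGroup n ℂ := by
  rw [mem_unitaryGroup_iff, star_eq_conjTranspose, reflection_conjTranspose,
    reflection_mul_self hV]

/-- The reflection R fixes the range of V, so the average acts on it as (R + 1)U/2, and R + 1 =
2VVᴴ. -/
lemma walk_average_mul {V : Matrix n m ℂ} (hV : Vᴴ * V = 1) (U : Matrix n n ℂ) :
    ((1 / 2 : ℂ) • (reflection V * U + U * reflection V)) * V = V * (Vᴴ * U * V) := by
  have h : reflection V * V = V := by
    rw [reflection, Matrix.sub_mul, Matrix.one_mul, Matrix.smul_mul, Matrix.mul_assoc, hV, Matrix.mul_one,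
      two_smul, add_sub_cancel_right]
  rw [Matrix.smul_mul, Matrix.add_mul, Matrix.mul_assoc U, h, reflection, Matrix.sub_mul,
    Matrix.one_mul, Matrix.sub_mul, sub_add_cancel, two_smul, Matrix.add_mul, Matrix.add_mul, ← two_smul ℂ, smul_smul]
  norm_num
  simp only [Matrix.mul_assoc]

lemma aeval_mul_of_intertwine {B : Matrix n n ℂ} {A : Matrix m m ℂ} {V : Matrix n m ℂ}
    (h : B * V = V * A) (q : Polynomial ℂ) :
    Polynomial.aeval B q * V = V * Polynomial.aeval A q := by
  have hpow : ∀ k : ℕ, B ^ k * V = V * A ^ k := by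
    intro k
    induction k with
    | zero => simp
    | succ k ih => rw [pow_succ, Matrix.mul_assoc, h, ← Matrix.mul_assoc, ih, Matrix.mul_assoc,
        ← pow_succ]
  rw [Polynomial.aeval_eq_sum_range, Polynomial.aeval_eq_sum_range, Matrix.sum_mul,
    Matrix.mul_sum]
  refine Finset.sum_congr rfl fun k _ => ?_
  rw [Matrix.smul_mul, hpow, Matrix.mul_smul]

/-- Since UR inverts RU, the power (UR)^d cancels the factor X^d that cleared the denominators. -/
lemma walkPolynomial_block {V : Matrix n m ℂ} (hV : Vᴴ * V = 1) {U : Matrix n n ℂ}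
    (hU : U * U = 1) {d : ℕ} {q : Polynomial ℂ} (hq : q.natDegree ≤ d) :
    Vᴴ * ((U * reflection V) ^ d *
      Polynomial.aeval (reflection V * U) (walkPolynomial d q)) * V =
      Polynomial.aeval (Vᴴ * U * V) q := by
  have hR := reflection_mul_self hV
  have h1 : reflection V * U * (U * reflection V) = 1 := by
    rw [Matrix.mul_assoc, ← Matrix.mul_assoc U, hU, Matrix.one_mul, hR]
  have h2 : U * reflection V * (reflection V * U) = 1 := by
    rw [Matrix.mul_assoc, ← Matrix.mul_assoc (reflection V), hR, Matrix.one_mul, hU]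
  have h3 : Commute (U * reflection V) (reflection V * U) := by
    rw [Commute, SemiconjBy, h1, h2]
  rw [aeval_walkPolynomial hq h1 h2, ← Matrix.mul_assoc ((U * reflection V) ^ d), ← h3.mul_pow,
    h2, one_pow, Matrix.one_mul, Matrix.mul_assoc,
    aeval_mul_of_intertwine (walk_average_mul hV U), ← Matrix.mul_assoc, hV, Matrix.one_mul]

end Walk

/-! ### Operators that query sequences realize -/

variable {M b : ℕ} {W : Type} [Fintype W] [DecidableEq W]

/-- An operator on the oracle registers, extended to the whole space. -/
def onOracleRegisters (W : Type) [DecidableEq W]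
    (O : Matrix ((Fin M × Fin M) × Bits b) ((Fin M × Fin M) × Bits b) ℂ) :
    Matrix (Reg M b W) (Reg M b W) ℂ :=
  (1 : Matrix (Fin M) (Fin M) ℂ) ⊗ₖ (O ⊗ₖ (1 : Matrix W W ℂ))

lemma onOracleRegisters_mul (O O' : Matrix ((Fin M × Fin M) × Bits b) ((Fin M × Fin M) × Bits b) ℂ) :
    onOracleRegisters W O * onOracleRegisters W O' = onOracleRegisters W (O * O') := by
  rw [onOracleRegisters, onOracleRegisters, ← mul_kronecker_mul, ← mul_kronecker_mul, one_mul,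
    one_mul, onOracleRegisters]

omit [Fintype W] in
lemma onOracleRegisters_conjTranspose
    (O : Matrix ((Fin M × Fin M) × Bits b) ((Fin M × Fin M) × Bits b) ℂ) :
    (onOracleRegisters W O)ᴴ = onOracleRegisters W Oᴴ := by
  simp [onOracleRegisters, conjTranspose_kronecker]

omit [Fintype W] in
lemma onOracleRegisters_one :
    onOracleRegisters W (1 : Matrix ((Fin M × Fin M) × Bits b) ((Fin M × Fin M) × Bits b) ℂ) = 1 := by
  simp [onOracleRegisters]

lemma oracleH_conjTranspose (h : Fin M → Fin M → Bits b) : (oracleH h)ᴴ = oracleH h := by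
  ext x y
  simp only [oracleH, conjTranspose_apply, of_apply]
  have hc : ∀ u : Bits b, u + u = 0 := fun u => by
    funext i; exact CharTwo.add_self_eq_zero (u i)
  have : (y.1 = x.1 ∧ y.2 = x.2 + h x.1.1 x.1.2) ↔ (x.1 = y.1 ∧ x.2 = y.2 + h y.1.1 y.1.2) := by
    constructor <;> rintro ⟨h1, h2⟩ <;> refine ⟨h1.symm, ?_⟩ <;>
      rw [h2, h1, add_assoc, hc, add_zero]
  simp only [this]
  split_ifs <;> simp

lemma oracleH_mul_self (h : Fin M → Fin M → Bits b) : oracleH h * oracleH h = 1 := by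
  have hc : ∀ u : Bits b, u + u = 0 := fun u => by
    funext i; exact CharTwo.add_self_eq_zero (u i)
  ext x y
  rw [mul_apply, Finset.sum_eq_single (y.1, y.2 + h y.1.1 y.1.2)]
  · simp [oracleH, one_apply, add_assoc, hc, Prod.ext_iff]
  · intro z _ hz
    have : ¬ (z.1 = y.1 ∧ z.2 = y.2 + h y.1.1 y.1.2) := fun h' => hz (Prod.ext h'.1 h'.2)
    simp [oracleH, this]
  · simp

lemma Gate.op_queryH (h : Fin M → Fin M → Bits b)
    (OF : Matrix (Fin M × Fin M) (Fin M × Fin M) ℂ) :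
    (Gate.queryH : Gate M b W).op h OF = onOracleRegisters W (oracleH h) := rfl

lemma Gate.op_queryF (h : Fin M → Fin M → Bits b)
    (OF : Matrix (Fin M × Fin M) (Fin M × Fin M) ℂ) :
    (Gate.queryF : Gate M b W).op h OF = onOracleRegisters W (OF ⊗ₖ 1) := rfl

lemma Gate.op_queryFinv (h : Fin M → Fin M → Bits b)
    (OF : Matrix (Fin M × Fin M) (Fin M × Fin M) ℂ) :
    (Gate.queryFinv : Gate M b W).op h OF = (onOracleRegisters W (OF ⊗ₖ 1))ᴴ := by
  rw [onOracleRegisters_conjTranspose, conjTranspose_kronecker, conjTranspose_one]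
  rfl

lemma onOracleRegisters_mem_unitaryGroup
    {O : Matrix ((Fin M × Fin M) × Bits b) ((Fin M × Fin M) × Bits b) ℂ} (hO : O * Oᴴ = 1) :
    onOracleRegisters W O ∈ unitaryGroup (Reg M b W) ℂ := by
  rw [mem_unitaryGroup_iff, star_eq_conjTranspose, onOracleRegisters_conjTranspose,
    onOracleRegisters_mul, hO, onOracleRegisters_one]

lemma queryH_mem_unitaryGroup (h : Fin M → Fin M → Bits b) :
    onOracleRegisters W (oracleH h) ∈ unitaryGroup (Reg M b W) ℂ :=
  onOracleRegisters_mem_unitaryGroup (by rw [oracleH_conjTranspose, oracleH_mul_self])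

lemma queryF_mem_unitaryGroup {OF : Matrix (Fin M × Fin M) (Fin M × Fin M) ℂ}
    (hOF : OF ∈ unitaryGroup (Fin M × Fin M) ℂ) :
    onOracleRegisters W (OF ⊗ₖ (1 : Matrix (Bits b) (Bits b) ℂ)) ∈ unitaryGroup (Reg M b W) ℂ :=
  onOracleRegisters_mem_unitaryGroup (by
    rw [conjTranspose_kronecker, ← mul_kronecker_mul, conjTranspose_one, one_mul,
      ← star_eq_conjTranspose, mem_unitaryGroup_iff.1 hOF, one_kronecker_one])

lemma Gate.op_mem_unitaryGroup (g : Gate M b W) (h : Fin M → Fin M → Bits b)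
    {OF : Matrix (Fin M × Fin M) (Fin M × Fin M) ℂ}
    (hOF : OF ∈ unitaryGroup (Fin M × Fin M) ℂ) :
    g.op h OF ∈ unitaryGroup (Reg M b W) ℂ := by
  cases g with
  | free U => exact U.2
  | queryH => exact queryH_mem_unitaryGroup h
  | queryF => exact queryF_mem_unitaryGroup hOF
  | queryFinv =>
    rw [Gate.op_queryFinv]
    exact Unitary.star_mem (queryF_mem_unitaryGroup hOF)

lemma foldl_op_mem_unitaryGroup (h : Fin M → Fin M → Bits b)
    {OF : Matrix (Fin M × Fin M) (Fin M × Fin M) ℂ}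
    (hOF : OF ∈ unitaryGroup (Fin M × Fin M) ℂ) (l : List (Gate M b W)) :
    ∀ A ∈ unitaryGroup (Reg M b W) ℂ,
      l.foldl (fun U g => g.op h OF * U) A ∈ unitaryGroup (Reg M b W) ℂ := by
  induction l with
  | nil => exact fun A hA => hA
  | cons g l ih => exact fun A hA => ih _ (mul_mem (g.op_mem_unitaryGroup h hOF) hA)

lemma foldl_op_eq (h : Fin M → Fin M → Bits b) (OF : Matrix (Fin M × Fin M) (Fin M × Fin M) ℂ)
    (l : List (Gate M b W)) : ∀ A : Matrix (Reg M b W) (Reg M b W) ℂ,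
      l.foldl (fun U g => g.op h OF * U) A = l.foldl (fun U g => g.op h OF * U) 1 * A := by
  induction l with
  | nil => simp
  | cons g l ih =>
    intro A
    rw [List.foldl_cons, List.foldl_cons, ih, ih (g.op h OF * 1), mul_one, Matrix.mul_assoc]

/-- Some sequence of gates with `k` queries performs the oracle-dependent operator `X`, for
every unitary `OF`. -/
def Realizes (k : ℕ) (X : (Fin M → Fin M → Bits b) → Matrix (Fin M × Fin M) (Fin M × Fin M) ℂ →
    Matrix (Reg M b W) (Reg M b W) ℂ) : Prop :=
  ∃ l : List (Gate M b W), (l.map Gate.cost).sum = k ∧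
    ∀ h, ∀ OF ∈ unitaryGroup (Fin M × Fin M) ℂ,
      l.foldl (fun U g => g.op h OF * U) 1 = X h OF

namespace Realizes

variable {k k' : ℕ} {X Y : (Fin M → Fin M → Bits b) →
  Matrix (Fin M × Fin M) (Fin M × Fin M) ℂ → Matrix (Reg M b W) (Reg M b W) ℂ}

lemma mul (hX : Realizes k X) (hY : Realizes k' Y) :
    Realizes (k + k') fun h OF => X h OF * Y h OF := by
  obtain ⟨l, hl, hlX⟩ := hX
  obtain ⟨l', hl', hlY⟩ := hY
  refine ⟨l' ++ l, by simp [hl, hl', add_comm], fun h OF hOF => ?_⟩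
  rw [List.foldl_append, foldl_op_eq, hlX h OF hOF, hlY h OF hOF]

lemma gate (g : Gate M b W) : Realizes g.cost fun h OF => g.op h OF :=
  ⟨[g], by simp, fun h OF _ => by simp⟩

lemma free {U : Matrix (Reg M b W) (Reg M b W) ℂ} (hU : U ∈ unitaryGroup (Reg M b W) ℂ) :
    Realizes 0 fun (_ : Fin M → Fin M → Bits b) _ => U :=
  gate (.free ⟨U, hU⟩)

lemma one : Realizes 0 fun (_ : Fin M → Fin M → Bits b) _ =>
    (1 : Matrix (Reg M b W) (Reg M b W) ℂ) :=
  ⟨[], rfl, fun _ _ _ => rfl⟩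

lemma congr (hX : Realizes k X)
    (h : ∀ h, ∀ OF ∈ unitaryGroup (Fin M × Fin M) ℂ, X h OF = Y h OF) : Realizes k Y := by
  obtain ⟨l, hl, hlX⟩ := hX
  exact ⟨l, hl, fun f OF hOF => (hlX f OF hOF).trans (h f OF hOF)⟩

lemma pow (hX : Realizes k X) (d : ℕ) : Realizes (d * k) fun h OF => X h OF ^ d := by
  induction d with
  | zero => simpa using one
  | succ d ih => simpa [pow_succ, Nat.succ_mul] using ih.mul hX

end Realizes

/-! ### Adding a control qubit -/

/-- The control qubit is the first part of the workspace. -/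
def controlEquiv (M b : ℕ) (W : Type) : Fin 2 × Reg M b W ≃ Reg M b (Fin 2 × W) where
  toFun x := (x.2.1, (x.2.2.1, (x.1, x.2.2.2)))
  invFun x := (x.2.2.1, (x.1, (x.2.1, x.2.2.2)))
  left_inv _ := rfl
  right_inv _ := rfl

/-- A `2 × 2` block operator as an operator on the space with a control qubit. -/
def withControl : Matrix (Fin 2) (Fin 2) (Matrix (Reg M b W) (Reg M b W) ℂ) ≃+*
    Matrix (Reg M b (Fin 2 × W)) (Reg M b (Fin 2 × W)) ℂ :=
  (compRingEquiv (Fin 2) (Reg M b W) ℂ).trans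
    (reindexRingEquiv ℂ (controlEquiv M b W))

omit [DecidableEq W] in
lemma withControl_apply (Z : Matrix (Fin 2) (Fin 2) (Matrix (Reg M b W) (Reg M b W) ℂ))
    (x y : Reg M b (Fin 2 × W)) :
    withControl Z x y =
      Z x.2.2.1 y.2.2.1 (x.1, (x.2.1, x.2.2.2)) (y.1, (y.2.1, y.2.2.2)) := rfl

lemma withControl_one :
    withControl (1 : Matrix (Fin 2) (Fin 2) (Matrix (Reg M b W) (Reg M b W) ℂ)) = 1 := by
  ext x y
  rw [withControl_apply, one_apply, one_apply]
  by_cases h : x.2.2.1 = y.2.2.1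
  · rw [if_pos h, one_apply]
    simp only [Prod.ext_iff, h, true_and]
  · rw [if_neg h, if_neg fun h' => h (by rw [h'])]
    rfl

omit [DecidableEq W] in
lemma withControl_conjTranspose
    (Z : Matrix (Fin 2) (Fin 2) (Matrix (Reg M b W) (Reg M b W) ℂ)) :
    (withControl Z)ᴴ = withControl Zᴴ := rfl

lemma withControl_mem_unitaryGroup
    {Z : Matrix (Fin 2) (Fin 2) (Matrix (Reg M b W) (Reg M b W) ℂ)} (hZ : Z * Zᴴ = 1) :
    withControl Z ∈ unitaryGroup (Reg M b (Fin 2 × W)) ℂ := by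
  rw [mem_unitaryGroup_iff, star_eq_conjTranspose, withControl_conjTranspose, ← map_mul, hZ,
    withControl_one]

lemma withControl_diagonal_mem_unitaryGroup {A B : Matrix (Reg M b W) (Reg M b W) ℂ}
    (hA : A ∈ unitaryGroup (Reg M b W) ℂ) (hB : B ∈ unitaryGroup (Reg M b W) ℂ) :
    withControl (diagonal ![A, B]) ∈ unitaryGroup (Reg M b (Fin 2 × W)) ℂ := by
  refine withControl_mem_unitaryGroup ?_
  rw [diagonal_conjTranspose, diagonal_mul_diagonal, ← diagonal_one]
  congr 1
  funext i
  fin_cases i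
  · exact mem_unitaryGroup_iff.1 hA
  · exact mem_unitaryGroup_iff.1 hB

omit [DecidableEq W] in
lemma withControl_diagonal_mul (A B A' B' : Matrix (Reg M b W) (Reg M b W) ℂ) :
    withControl (diagonal ![A, B]) * withControl (diagonal ![A', B']) =
      withControl (diagonal ![A * A', B * B']) := by
  rw [← map_mul, diagonal_mul_diagonal]
  congr 2
  funext i
  fin_cases i <;> rfl

lemma withControl_diagonal_pow (A B : Matrix (Reg M b W) (Reg M b W) ℂ) (d : ℕ) :
    withControl (diagonal ![A, B]) ^ d = withControl (diagonal ![A ^ d, B ^ d]) := by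
  induction d with
  | zero =>
    rw [pow_zero, ← withControl_one, ← diagonal_one]
    congr 2
    funext i
    fin_cases i <;> simp
  | succ d ih => rw [pow_succ, ih, withControl_diagonal_mul, pow_succ, pow_succ]

lemma withControl_map_mem_unitaryGroup {R : Matrix (Fin 2) (Fin 2) ℂ}
    (hR : R ∈ unitaryGroup (Fin 2) ℂ) :
    withControl (R.map (algebraMap ℂ (Matrix (Reg M b W) (Reg M b W) ℂ))) ∈
      unitaryGroup (Reg M b (Fin 2 × W)) ℂ := by
  refine withControl_mem_unitaryGroup ?_
  have h : (R.map (algebraMap ℂ (Matrix (Reg M b W) (Reg M b W) ℂ)))ᴴ =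
      Rᴴ.map (algebraMap ℂ (Matrix (Reg M b W) (Reg M b W) ℂ)) := by
    ext i j : 2
    simp only [conjTranspose_apply, Matrix.map_apply]
    rw [Algebra.algebraMap_eq_smul_one, Algebra.algebraMap_eq_smul_one, star_smul, star_one]
  rw [h, ← Matrix.map_mul, ← star_eq_conjTranspose, mem_unitaryGroup_iff.1 hR]
  exact Matrix.map_one _ (map_zero _) (map_one _)

/-- A query acts alike on both blocks of the control qubit, so no controlled oracle is needed. -/
lemma onOracleRegisters_control
    (O : Matrix ((Fin M × Fin M) × Bits b) ((Fin M × Fin M) × Bits b) ℂ) :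
    onOracleRegisters (Fin 2 × W) O =
      withControl (diagonal ![onOracleRegisters W O, onOracleRegisters W O]) := by
  ext x y
  obtain ⟨j, a, c, w⟩ := x
  obtain ⟨j', a', c', w'⟩ := y
  rw [withControl_apply]
  by_cases hc : c = c'
  · subst hc
    fin_cases c <;> simp [onOracleRegisters, kroneckerMap_apply, one_apply]
  · simp [onOracleRegisters, kroneckerMap_apply, one_apply, hc, diagonal]

/-! ### The transformation circuit -/

/-- The part of the circuit that precedes the central Hermitian unitary. -/
def conjugator (Pr Sw : Matrix (Reg M b W) (Reg M b W) ℂ) (h : Fin M → Fin M → Bits b)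
    (OF : Matrix (Fin M × Fin M) (Fin M × Fin M) ℂ) : Matrix (Reg M b W) (Reg M b W) ℂ :=
  onOracleRegisters W (oracleH h) * Sw * onOracleRegisters W (OF ⊗ₖ 1) * Pr

/-- The Hermitian unitary that encodes the Hamiltonian. -/
def encoding (Pr Sw N : Matrix (Reg M b W) (Reg M b W) ℂ) (h : Fin M → Fin M → Bits b)
    (OF : Matrix (Fin M × Fin M) (Fin M × Fin M) ℂ) : Matrix (Reg M b W) (Reg M b W) ℂ :=
  (conjugator Pr Sw h OF)ᴴ * N * conjugator Pr Sw h OF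

variable {Pr Sw N : Matrix (Reg M b W) (Reg M b W) ℂ}

lemma conjugator_mem_unitaryGroup (hPr : Pr ∈ unitaryGroup (Reg M b W) ℂ)
    (hSw : Sw ∈ unitaryGroup (Reg M b W) ℂ) (h : Fin M → Fin M → Bits b)
    {OF : Matrix (Fin M × Fin M) (Fin M × Fin M) ℂ}
    (hOF : OF ∈ unitaryGroup (Fin M × Fin M) ℂ) :
    conjugator Pr Sw h OF ∈ unitaryGroup (Reg M b W) ℂ :=
  mul_mem (mul_mem (mul_mem (queryH_mem_unitaryGroup h) hSw) (queryF_mem_unitaryGroup hOF)) hPr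

lemma encoding_mul_self (hPr : Pr ∈ unitaryGroup (Reg M b W) ℂ)
    (hSw : Sw ∈ unitaryGroup (Reg M b W) ℂ) (hN : N * N = 1) (h : Fin M → Fin M → Bits b)
    {OF : Matrix (Fin M × Fin M) (Fin M × Fin M) ℂ}
    (hOF : OF ∈ unitaryGroup (Fin M × Fin M) ℂ) :
    encoding Pr Sw N h OF * encoding Pr Sw N h OF = 1 := by
  have hL := conjugator_mem_unitaryGroup hPr hSw h hOF
  have h1 : conjugator Pr Sw h OF * (conjugator Pr Sw h OF)ᴴ = 1 := mem_unitaryGroup_iff.1 hL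
  have h2 : (conjugator Pr Sw h OF)ᴴ * conjugator Pr Sw h OF = 1 := mem_unitaryGroup_iff'.1 hL
  rw [encoding]
  generalize conjugator Pr Sw h OF = L at *
  calc Lᴴ * N * L * (Lᴴ * N * L) = Lᴴ * (N * (L * Lᴴ) * N) * L := by
        simp only [Matrix.mul_assoc]
    _ = 1 := by rw [h1, Matrix.mul_one, hN, Matrix.mul_one, h2]

lemma realizes_withControl_conjugator (hPr : Pr ∈ unitaryGroup (Reg M b W) ℂ)
    (hSw : Sw ∈ unitaryGroup (Reg M b W) ℂ) :
    Realizes 2 fun h OF => withControl (diagonal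
      ![conjugator Pr Sw h OF, conjugator Pr Sw h OF]) := by
  have h1 := (((Realizes.gate (Gate.queryH : Gate M b (Fin 2 × W))).mul
    (Realizes.free (withControl_diagonal_mem_unitaryGroup hSw hSw))).mul
    (Realizes.gate Gate.queryF)).mul
    (Realizes.free (withControl_diagonal_mem_unitaryGroup hPr hPr))
  simp only [Gate.op_queryH, Gate.op_queryF, onOracleRegisters_control,
    withControl_diagonal_mul] at h1
  exact h1

lemma realizes_withControl_conjugator_conjTranspose (hPr : Pr ∈ unitaryGroup (Reg M b W) ℂ)
    (hSw : Sw ∈ unitaryGroup (Reg M b W) ℂ) :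
    Realizes 2 fun h OF => withControl (diagonal
      ![(conjugator Pr Sw h OF)ᴴ, (conjugator Pr Sw h OF)ᴴ]) := by
  have hPr' := Unitary.star_mem hPr
  have hSw' := Unitary.star_mem hSw
  rw [star_eq_conjTranspose] at hPr' hSw'
  have h1 := (Realizes.free (withControl_diagonal_mem_unitaryGroup hPr' hPr')).mul
    ((Realizes.gate (Gate.queryFinv : Gate M b (Fin 2 × W))).mul
    ((Realizes.free (withControl_diagonal_mem_unitaryGroup hSw' hSw')).mul
    (Realizes.gate (Gate.queryH : Gate M b (Fin 2 × W)))))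
  simp only [Gate.op_queryH, Gate.op_queryFinv, onOracleRegisters_conjTranspose] at h1
  simp only [onOracleRegisters_control, withControl_diagonal_mul] at h1
  simp only [conjugator, conjTranspose_mul, onOracleRegisters_conjTranspose,
    oracleH_conjTranspose]
  exact h1

/-- Only the central unitary depends on the control qubit. With `N' = 1` the two conjugators cancel
in the second block, which turns uncontrolled queries into a controlled encoding. -/
lemma realizes_controlled_encoding (hPr : Pr ∈ unitaryGroup (Reg M b W) ℂ)
    (hSw : Sw ∈ unitaryGroup (Reg M b W) ℂ) (hN : N ∈ unitaryGroup (Reg M b W) ℂ)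
    {N' : Matrix (Reg M b W) (Reg M b W) ℂ} (hN' : N' ∈ unitaryGroup (Reg M b W) ℂ) :
    Realizes 4 fun h OF => withControl (diagonal
      ![encoding Pr Sw N h OF, encoding Pr Sw N' h OF]) := by
  have h1 := ((realizes_withControl_conjugator_conjTranspose hPr hSw).mul
    (Realizes.free (withControl_diagonal_mem_unitaryGroup hN hN'))).mul
    (realizes_withControl_conjugator hPr hSw)
  simp only [withControl_diagonal_mul] at h1
  exact h1

omit [DecidableEq W] [Fintype W] in
lemma mapMatrix_aeval_signalStep {n : Type*} [Fintype n] [DecidableEq n] (w : Matrix n n ℂ)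
    (R : Matrix (Fin 2) (Fin 2) ℂ) :
    (Polynomial.aeval w).toRingHom.mapMatrix (signalStep R) =
      R.map (algebraMap ℂ (Matrix n n ℂ)) * diagonal ![w, 1] := by
  rw [signalStep, map_mul]
  congr 1
  · ext i j : 2
    simp
  · ext i j : 2
    fin_cases i <;> fin_cases j <;> simp

lemma realizes_signal_sequence {X : (Fin M → Fin M → Bits b) →
      Matrix (Fin M × Fin M) (Fin M × Fin M) ℂ → Matrix (Reg M b W) (Reg M b W) ℂ} {k : ℕ}
    (hX : Realizes k fun h OF => withControl (diagonal ![X h OF, 1]))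
    (l : List (unitaryGroup (Fin 2) ℂ)) (R₀ : unitaryGroup (Fin 2) ℂ) :
    Realizes (l.length * k) fun h OF => withControl
      ((Polynomial.aeval (X h OF)).toRingHom.mapMatrix
        ((l.map fun R => signalStep R.1).prod * R₀.1.map Polynomial.C)) := by
  induction l with
  | nil =>
    have h1 := Realizes.free (M := M) (b := b) (W := Fin 2 × W)
      (withControl_map_mem_unitaryGroup R₀.2)
    convert h1 using 4
    · simp
    · ext i j : 2
      simp
  | cons R l ih =>
    have h1 := ((Realizes.free (M := M) (b := b) (W := Fin 2 × W)
      (withControl_map_mem_unitaryGroup R.2)).mul hX).mul ih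
    convert h1 using 3
    · rw [List.length_cons]; ring
    · rw [← map_mul, ← map_mul, List.map_cons, List.prod_cons, Matrix.mul_assoc, map_mul,
        mapMatrix_aeval_signalStep]

/-- Polynomial transformation of an encoded matrix: polynomials of degree `d` that are bounded
on `[-1, 1]` can be applied with `O(d)` queries. -/
theorem exists_transformation_algorithm (start : Ancilla M b W)
    (hPr : Pr ∈ unitaryGroup (Reg M b W) ℂ) (hSw : Sw ∈ unitaryGroup (Reg M b W) ℂ)
    (hN : Nᴴ = N) (hNN : N * N = 1) {d : ℕ} {q : Polynomial ℂ} (hq : q.natDegree ≤ d)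
    (hq1 : ∀ y : ℝ, |y| ≤ 1 → ‖q.eval (y : ℂ)‖ < 1) :
    ∃ A : QueryAlgorithm M b, A.queries = 12 * d ∧
      ∀ h, ∀ OF ∈ unitaryGroup (Fin M × Fin M) ℂ,
        A.op h OF ∈ unitaryGroup _ ℂ ∧
        (A.op h OF).submatrix (fun i => (i, A.start)) (fun i => (i, A.start)) =
          Polynomial.aeval ((embedAt (m := Fin M) start)ᴴ * encoding Pr Sw N h OF *
            embedAt (m := Fin M) start) q := by
  obtain ⟨Q, hQ, hPQ⟩ := exists_complementary_polynomial (natDegree_walkPolynomial_le d q)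
    fun z hz => norm_eval_walkPolynomial_lt hq hq1 hz
  obtain ⟨l, R₀, hl, hP, -⟩ := exists_signal_sequence (2 * d) _ Q
    (natDegree_walkPolynomial_le d q) hQ hPQ
  have hNu : N ∈ unitaryGroup (Reg M b W) ℂ := by
    rw [mem_unitaryGroup_iff, star_eq_conjTranspose, hN, hNN]
  set V := embedAt (m := Fin M) start
  have hV : Vᴴ * V = 1 := embedAt_conjTranspose_mul_self start
  have hR := reflection_mem_unitaryGroup hV
  have hone : (1 : Matrix (Reg M b W) (Reg M b W) ℂ) ∈ unitaryGroup (Reg M b W) ℂ := one_mem _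
  -- The inverse walk needs no control and costs 4d queries; the 2d signal steps cost four each, for
  -- a total of 12d.
  have hw' := ((realizes_controlled_encoding hPr hSw hNu hNu).mul
    (Realizes.free (withControl_diagonal_mem_unitaryGroup hR hR))).pow d
  have hw : Realizes 4 fun h OF =>
      withControl (diagonal ![reflection V * encoding Pr Sw N h OF, 1]) := by
    refine ((Realizes.free (withControl_diagonal_mem_unitaryGroup hR hone)).mul
      (realizes_controlled_encoding hPr hSw hNu hone)).congr fun h OF hOF => ?_
    have h1 : encoding Pr Sw 1 h OF = 1 := by
      rw [encoding, Matrix.mul_one]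
      exact mem_unitaryGroup_iff'.1 (conjugator_mem_unitaryGroup hPr hSw h hOF)
    rw [withControl_diagonal_mul, h1, Matrix.mul_one]
  obtain ⟨g, hg, hgop⟩ := hw'.mul (realizes_signal_sequence hw l R₀)
  -- The control qubit starts in state 0, so the diagonal block selects the entry P of the signal
  -- sequence.
  refine ⟨⟨Fin 2 × W, (start.1, (0, start.2)), g⟩, ?_, fun h OF hOF => ⟨?_, ?_⟩⟩
  · rw [QueryAlgorithm.queries, hg, hl]; ring
  · exact foldl_op_mem_unitaryGroup h hOF g 1 (one_mem _)
  · have hUU := encoding_mul_self hPr hSw hNN h hOF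
    have hop := hgop h OF hOF
    beta_reduce at hop
    rw [withControl_diagonal_mul, withControl_diagonal_pow, ← map_mul] at hop
    rw [QueryAlgorithm.op, hop, ← walkPolynomial_block hV hUU hq, embedAt_conjTranspose_mul_mul]
    ext i j
    rw [submatrix_apply, submatrix_apply, withControl_apply]
    simp only [diagonal_mul, RingHom.mapMatrix_apply, Matrix.map_apply, hP]
    rfl

end Circuits

/-! ### Block encoding of a sparse Hermitian matrix -/

section BlockEncoding

open Matrix

section Isometry

variable {n m ι : Type*} [Fintype n] [DecidableEq n] [Fintype m] [DecidableEq m]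

/-- Every isometry is the restriction of a unitary to the ancilla state `s`. -/
lemma exists_unitary_mul_embedAt (s : n) {X : Matrix (m × n) m ℂ} (hX : Xᴴ * X = 1) :
    ∃ U ∈ unitaryGroup (m × n) ℂ, U * embedAt (m := m) s = X := by
  -- Only the vectors with `x.2 = s` are kept; they are extended to an orthonormal basis with the
  -- full index set.
  let v : m × n → EuclideanSpace ℂ (m × n) := fun x => WithLp.toLp 2 fun y => X y x.1
  have hv : Orthonormal ℂ ({x : m × n | x.2 = s}.domRestrict v) := by
    rw [orthonormal_iff_ite]
    rintro ⟨⟨i, t⟩, ht⟩ ⟨⟨j, t'⟩, ht'⟩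
    obtain rfl : t = s := ht
    obtain rfl : t' = t := ht'
    have h := congrFun (congrFun hX i) j
    simp only [mul_apply, conjTranspose_apply, one_apply] at h
    simp only [Subtype.mk.injEq, Prod.mk.injEq, and_true]
    rw [← h, PiLp.inner_apply]
    refine Finset.sum_congr rfl fun y _ => ?_
    change inner ℂ (X y i) (X y j) = _
    simp [mul_comm]
  obtain ⟨e, he⟩ := hv.exists_orthonormalBasis_extension_of_card_eq (by simp)
  refine ⟨of fun y x => e x y, ?_, ?_⟩
  · rw [mem_unitaryGroup_iff']
    ext i j
    have h := orthonormal_iff_ite.1 e.orthonormal i j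
    rw [one_apply, ← h, PiLp.inner_apply, mul_apply]
    refine Finset.sum_congr rfl fun y _ => ?_
    simp [mul_comm, star_apply]
  · ext y i
    have h := he (i, s) rfl
    simp only [embedAt, mul_apply, of_apply, submatrix_apply, id, one_apply, mul_ite, mul_one,
      mul_zero, Finset.sum_ite_eq', Finset.mem_univ, if_true]
    rw [h]

/-- The matrix whose columns are the basis vectors with labels `g i`. -/
def basisColumns (g : ι → n) : Matrix n ι ℂ := (1 : Matrix n n ℂ).submatrix id g

omit [Fintype n] in
lemma basisColumns_apply (g : ι → n) (x : n) (i : ι) :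
    basisColumns g x i = if x = g i then 1 else 0 := by
  simp [basisColumns, one_apply]

lemma mul_basisColumns_eq {A : Matrix n n ℂ} {g g' : ι → n}
    (h : ∀ x i, A x (g i) = if x = g' i then 1 else 0) :
    A * basisColumns g = basisColumns g' := by
  ext x i
  rw [basisColumns_apply, ← h, mul_apply]
  simp [basisColumns_apply]

lemma basisColumns_conjTranspose_mul_mul (A : Matrix n n ℂ) (g : ι → n) :
    (basisColumns g)ᴴ * A * basisColumns g = A.submatrix g g := by
  ext i j
  simp [basisColumns_apply, mul_apply]

end Isometry

variable {M b D : ℕ}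

/-- A Hermitian unitary of size four that encodes a number `a` of absolute value at most one. -/
noncomputable def entryUnitary (a : ℂ) : Matrix (Fin 4) (Fin 4) ℂ :=
  let β : ℂ := (Real.sqrt (1 - ‖a‖ ^ 2) : ℝ)
  !![0, starRingEnd ℂ a, β, 0; a, 0, 0, β; β, 0, 0, -starRingEnd ℂ a; 0, β, -a, 0]

lemma entryUnitary_conjTranspose (a : ℂ) : (entryUnitary a)ᴴ = entryUnitary a := by
  ext i j
  fin_cases i <;> fin_cases j <;> simp [entryUnitary]

/-- The entries β = √(1 - |a|²) dilate the Hermitian contraction with off-diagonal entries a and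
conj a; the bound on a makes β² = 1 - |a|². -/
lemma entryUnitary_mul_self {a : ℂ} (ha : ‖a‖ ≤ 1) : entryUnitary a * entryUnitary a = 1 := by
  have h1 : ((Real.sqrt (1 - ‖a‖ ^ 2) : ℝ) : ℂ) * (Real.sqrt (1 - ‖a‖ ^ 2) : ℝ) =
      1 - a * starRingEnd ℂ a := by
    rw [← Complex.ofReal_mul, Real.mul_self_sqrt (by nlinarith [norm_nonneg a]),
      Complex.mul_conj']
    push_cast; rfl
  ext i j
  generalize hβ : ((Real.sqrt (1 - ‖a‖ ^ 2) : ℝ) : ℂ) = β at h1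
  fin_cases i <;> fin_cases j <;>
    simp [entryUnitary, mul_apply, Fin.sum_univ_four, hβ] <;>
    first | linear_combination h1 | ring

/-- The central unitary: `entryUnitary` on the workspace, with the number `a z` computed from the
bit string `z`. -/
noncomputable def centralUnitary (M : ℕ) (a : Bits b → ℂ) : Matrix (Reg M b (Fin 4)) (Reg M b (Fin 4)) ℂ :=
  of fun x y => if x.1 = y.1 ∧ x.2.1 = y.2.1 then entryUnitary (a x.2.1.2) x.2.2 y.2.2 else 0

lemma centralUnitary_conjTranspose (a : Bits b → ℂ) :
    (centralUnitary M a)ᴴ = centralUnitary M a := by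
  ext x y
  simp only [centralUnitary, conjTranspose_apply, of_apply]
  by_cases h : x.1 = y.1 ∧ x.2.1 = y.2.1
  · rw [if_pos h, if_pos ⟨h.1.symm, h.2.symm⟩, h.2, ← conjTranspose_apply,
      entryUnitary_conjTranspose]
  · rw [if_neg h, if_neg fun h' => h ⟨h'.1.symm, h'.2.symm⟩, star_zero]

lemma centralUnitary_mul_self {a : Bits b → ℂ} (ha : ∀ z, ‖a z‖ ≤ 1) :
    centralUnitary M a * centralUnitary M a = 1 := by
  ext x y
  rw [mul_apply, Fintype.sum_prod_type, Finset.sum_eq_single x.1, Fintype.sum_prod_type,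
    Finset.sum_eq_single x.2.1]
  · have h := congrFun (congrFun (entryUnitary_mul_self (ha x.2.1.2)) x.2.2) y.2.2
    rw [mul_apply] at h
    simp only [centralUnitary, of_apply, and_self, if_true]
    by_cases hxy : x.1 = y.1 ∧ x.2.1 = y.2.1
    · simp only [hxy, and_self, if_true] at h ⊢
      rw [h, one_apply, one_apply]
      simp [Prod.ext_iff, hxy]
    · simp only [hxy, if_false, mul_zero, Finset.sum_const_zero]
      rw [one_apply, if_neg]
      rintro rfl
      exact hxy ⟨rfl, rfl⟩
  · intro c _ hc
    exact Finset.sum_eq_zero fun w _ => by simp [centralUnitary, hc.symm]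
  · simp
  · intro c _ hc
    exact Finset.sum_eq_zero fun w _ => by simp [centralUnitary, hc.symm]
  · simp

/-- Exchange of the registers `j` and `k`, controlled by the workspace. -/
def controlledSwapEquiv (M b : ℕ) : Equiv.Perm (Reg M b (Fin 4)) :=
  Function.Involutive.toPerm
    (fun x => if x.2.2 = 0 then (x.1, ((x.2.1.1.swap, x.2.1.2), x.2.2)) else x) (by
      rintro ⟨x, y, w⟩
      by_cases h : w = 0 <;> simp [h])

/-- The unitary of `controlledSwapEquiv`. -/
def controlledSwap (M b : ℕ) : Matrix (Reg M b (Fin 4)) (Reg M b (Fin 4)) ℂ :=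
  (1 : Matrix (Reg M b (Fin 4)) (Reg M b (Fin 4)) ℂ).submatrix id (controlledSwapEquiv M b)

lemma controlledSwap_mem_unitaryGroup :
    controlledSwap M b ∈ unitaryGroup (Reg M b (Fin 4)) ℂ := by
  rw [mem_unitaryGroup_iff', controlledSwap, star_eq_conjTranspose, conjTranspose_submatrix,
    conjTranspose_one, ← submatrix_mul _ _ _ id _ Function.bijective_id, one_mul,
    submatrix_one_equiv]

/-- Labels of the basis states after preparation of the registers. -/
def preparedLabel (hM : 0 < M) (hD : D ≤ M) (p : Fin M × Fin D × Fin 2) : Reg M b (Fin 4) :=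
  (⟨0, hM⟩, (((p.1, Fin.castLE hD p.2.1), 0), Fin.castLE (by norm_num) p.2.2))

/-- Labels of the basis states after the query to `O_F`. -/
def neighbourLabel (hM : 0 < M) (f : Fin M → Fin D → Fin M) (p : Fin M × Fin D × Fin 2) :
    Reg M b (Fin 4) :=
  (⟨0, hM⟩, (((p.1, f p.1 p.2.1), 0), Fin.castLE (by norm_num) p.2.2))

/-- Labels of the basis states after the query to `O_H`. -/
def entryLabel (hM : 0 < M) (f : Fin M → Fin D → Fin M) (h : Fin M → Fin M → Bits b)
    (p : Fin M × Fin D × Fin 2) : Reg M b (Fin 4) :=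
  (⟨0, hM⟩, if p.2.2 = 0 then (((f p.1 p.2.1, p.1), h (f p.1 p.2.1) p.1), 0)
    else (((p.1, f p.1 p.2.1), h p.1 (f p.1 p.2.1)), 1))

lemma preparedLabel_injective (hM : 0 < M) (hD : D ≤ M) :
    Function.Injective (preparedLabel (b := b) hM hD) := by
  rintro ⟨j, k, s⟩ ⟨j', k', s'⟩ h
  simp only [preparedLabel, Prod.mk.injEq, true_and, and_true, Fin.castLE_inj] at h
  simp [h]

/-- The superposition over the second and the third component. -/
noncomputable def superpose (M D : ℕ) : Matrix (Fin M × Fin D × Fin 2) (Fin M) ℂ :=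
  of fun p j => if p.1 = j then ((Real.sqrt (2 * D))⁻¹ : ℝ) else 0

lemma superpose_conj_apply (A : Matrix (Fin M × Fin D × Fin 2) (Fin M × Fin D × Fin 2) ℂ)
    (i j : Fin M) : ((superpose M D)ᴴ * A * superpose M D) i j =
      (1 / (2 * D) : ℂ) * ∑ p : Fin D × Fin 2, ∑ p' : Fin D × Fin 2, A (i, p) (j, p') := by
  have hc : (((Real.sqrt (2 * D))⁻¹ : ℝ) : ℂ) * ((Real.sqrt (2 * D))⁻¹ : ℝ) = 1 / (2 * D) := by
    rw [← Complex.ofReal_mul, ← mul_inv, Real.mul_self_sqrt (by positivity)]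
    push_cast; rw [one_div]
  simp only [mul_apply, superpose, conjTranspose_apply, of_apply]
  generalize (Real.sqrt (2 * D))⁻¹ = c at hc
  have hsum : ∀ (G : Fin M × Fin D × Fin 2 → ℂ) (i : Fin M),
      ∑ p, G p * (if p.1 = i then (c : ℂ) else 0) = c * ∑ p : Fin D × Fin 2, G (i, p) := by
    intro G i
    rw [Fintype.sum_prod_type, Finset.sum_eq_single i]
    · simp [Finset.mul_sum, mul_comm]
    · intro i' _ hi
      simp [hi]
    · simp
  have hstar : ∀ (p : Fin M × Fin D × Fin 2), star (if p.1 = i then (c : ℂ) else 0) =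
      if p.1 = i then (c : ℂ) else 0 := fun p => by split_ifs <;> simp
  simp only [hstar, mul_comm (ite _ _ _) (A _ _), hsum]
  rw [← Finset.mul_sum, ← mul_assoc, hc, Finset.sum_comm]

/-- The oracles see only ancillas, so the preparation moves the input index j into their first
register and leaves the system in state 0. It remains an isometry because j is still recorded. -/
lemma basisColumns_mul_superpose_isometry (hM : 0 < M) (hD : D ≤ M) (hD0 : 0 < D) :
    (basisColumns (preparedLabel (b := b) hM hD) * superpose M D)ᴴ *
      (basisColumns (preparedLabel (b := b) hM hD) * superpose M D) = 1 := by
  have h1 : (basisColumns (preparedLabel (b := b) hM hD))ᴴ *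
      basisColumns (preparedLabel (b := b) hM hD) = 1 := by
    have := basisColumns_conjTranspose_mul_mul 1 (preparedLabel (b := b) hM hD)
    rw [Matrix.mul_one] at this
    rw [this, submatrix_one _ (preparedLabel_injective hM hD)]
  rw [conjTranspose_mul, Matrix.mul_assoc, ← Matrix.mul_assoc _ (basisColumns _), h1,
    ← Matrix.mul_assoc]
  ext i j
  have hD' : (D : ℂ) ≠ 0 := by exact_mod_cast hD0.ne'
  rw [superpose_conj_apply]
  by_cases hij : i = j
  · subst hij
    simp [one_apply]
    field_simp
  · simp [one_apply, hij]

/-- Number of positions at which the row `i` is listed for the column `j`. -/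
def listed (f : Fin M → Fin D → Fin M) (i j : Fin M) : ℕ :=
  (Finset.univ.filter fun k => f j k = i).card

/-- O_F replaces k by f(j,k), the swap turns (j, f(j,k)) around in branch 0 only, and O_H then
writes the entry at that position. -/
lemma mul_basisColumns_prepared (hM : 0 < M) (hD : D ≤ M) (h : Fin M → Fin M → Bits b)
    {OF : Matrix (Fin M × Fin M) (Fin M × Fin M) ℂ} {f : Fin M → Fin D → Fin M}
    (hf : ∀ (j : Fin M) (k : Fin D) (x : Fin M × Fin M),
      OF x (j, Fin.castLE hD k) = if x = (j, f j k) then 1 else 0) :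
    onOracleRegisters (Fin 4) (oracleH h) * (controlledSwap M b *
      (onOracleRegisters (Fin 4) (OF ⊗ₖ (1 : Matrix (Bits b) (Bits b) ℂ)) *
        basisColumns (preparedLabel (b := b) hM hD))) = basisColumns (entryLabel hM f h) := by
  have h1 : onOracleRegisters (Fin 4) (OF ⊗ₖ (1 : Matrix (Bits b) (Bits b) ℂ)) *
      basisColumns (preparedLabel (b := b) hM hD) = basisColumns (neighbourLabel (b := b) hM f) := by
    refine mul_basisColumns_eq fun x p => ?_
    obtain ⟨x1, ⟨x2, x3⟩, x4⟩ := x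
    simp only [onOracleRegisters, kroneckerMap_apply, preparedLabel, hf, neighbourLabel,
      one_apply, Prod.mk.injEq]
    simp only [ite_zero_mul_ite_zero, mul_one]
  have h2 : controlledSwap M b * basisColumns (neighbourLabel (b := b) hM f) =
      basisColumns (controlledSwapEquiv M b ∘ neighbourLabel (b := b) hM f) := by
    refine mul_basisColumns_eq fun x p => ?_
    simp [controlledSwap, one_apply]
  rw [h1, h2]
  refine mul_basisColumns_eq fun x p => ?_
  obtain ⟨x1, ⟨x2, x3⟩, x4⟩ := x
  obtain ⟨j, k, s⟩ := p
  fin_cases s <;>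
  · simp [onOracleRegisters, kroneckerMap_apply, neighbourLabel, entryLabel, controlledSwapEquiv,
      one_apply, oracleH]
    split_ifs <;> simp_all

/-- Equal branches have amplitude zero. In opposite branches the oracle registers agree exactly when
i and j list each other; both then hold the same bit string, and the two orders of the branches give
a(h i j) and the conjugate of a(h j i). -/
lemma sum_centralUnitary_entryLabel (hM : 0 < M) (f : Fin M → Fin D → Fin M)
    (h : Fin M → Fin M → Bits b) (a : Bits b → ℂ) (i j : Fin M) :
    ∑ p : Fin D × Fin 2, ∑ p' : Fin D × Fin 2,
      (centralUnitary M a).submatrix (entryLabel hM f h) (entryLabel hM f h) (i, p) (j, p') =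
      (listed f i j * listed f j i : ℂ) * (a (h i j) + starRingEnd ℂ (a (h j i))) := by
  have hterm : ∀ k k' : Fin D, ∑ s : Fin 2, ∑ s' : Fin 2,
      (centralUnitary M a).submatrix (entryLabel hM f h) (entryLabel hM f h)
        (i, k, s) (j, k', s') =
      (if f i k = j then 1 else 0) * (if f j k' = i then 1 else 0) *
        (a (h i j) + starRingEnd ℂ (a (h j i))) := by
    intro k k'
    simp only [Fin.sum_univ_two, submatrix_apply, entryLabel, centralUnitary, of_apply,
      Fin.isValue, if_true, one_ne_zero, if_false, true_and, Prod.mk.injEq]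
    by_cases h1 : f i k = j
    · by_cases h2 : f j k' = i
      · subst h1
        simp [h2, entryUnitary, add_comm]
      · simp [h1, h2, entryUnitary, Ne.symm h2]
    · simp [h1, entryUnitary]
  have hl : ∀ i j : Fin M, (listed f i j : ℂ) = ∑ k, if f j k = i then 1 else 0 := by
    intro i j
    rw [listed, Finset.natCast_card_filter]
  rw [hl, hl, mul_comm (∑ k, _), Finset.sum_mul_sum, Finset.sum_mul]
  simp only [Fintype.sum_prod_type]
  refine Finset.sum_congr rfl fun k _ => ?_
  rw [Finset.sum_comm, Finset.sum_mul]
  exact Finset.sum_congr rfl fun k' _ => hterm k k'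

/-- The matrix that is encoded when the entries are given by `a`. -/
noncomputable def encodedMatrix (f : Fin M → Fin D → Fin M) (h : Fin M → Fin M → Bits b)
    (a : Bits b → ℂ) : Matrix (Fin M) (Fin M) ℂ :=
  of fun i j => (1 / (2 * D) : ℂ) *
    ((listed f i j * listed f j i : ℂ) * (a (h i j) + starRingEnd ℂ (a (h j i))))

lemma exists_preparation (b : ℕ) (hM : 0 < M) (hD : D ≤ M) (hD0 : 0 < D) :
    ∃ (start : Ancilla M b (Fin 4)), ∃ Pr ∈ unitaryGroup (Reg M b (Fin 4)) ℂ,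
      ∀ (a : Bits b → ℂ) (h : Fin M → Fin M → Bits b)
        (OF : Matrix (Fin M × Fin M) (Fin M × Fin M) ℂ) (f : Fin M → Fin D → Fin M),
        (∀ (j : Fin M) (k : Fin D) (x : Fin M × Fin M),
          OF x (j, Fin.castLE hD k) = if x = (j, f j k) then 1 else 0) →
        (embedAt (m := Fin M) start)ᴴ *
            encoding Pr (controlledSwap M b) (centralUnitary M a) h OF *
              embedAt (m := Fin M) start = encodedMatrix f h a := by
  let start : Ancilla M b (Fin 4) := (((⟨0, hM⟩, ⟨0, hM⟩), 0), 0)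
  obtain ⟨Pr, hPr, hPrX⟩ := exists_unitary_mul_embedAt start
    (basisColumns_mul_superpose_isometry (b := b) hM hD hD0)
  refine ⟨start, Pr, hPr, fun a h OF f hf => ?_⟩
  have hY : conjugator Pr (controlledSwap M b) h OF * embedAt (m := Fin M) start =
      basisColumns (entryLabel hM f h) * superpose M D := by
    rw [conjugator, Matrix.mul_assoc, hPrX, ← mul_basisColumns_prepared hM hD h hf]
    simp only [Matrix.mul_assoc]
  have h1 : (embedAt (m := Fin M) start)ᴴ *
      encoding Pr (controlledSwap M b) (centralUnitary M a) h OF * embedAt (m := Fin M) start =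
      (superpose M D)ᴴ * ((basisColumns (entryLabel hM f h))ᴴ * centralUnitary M a *
        basisColumns (entryLabel hM f h)) * superpose M D := by
    have h2 := congrArg conjTranspose hY
    rw [conjTranspose_mul, conjTranspose_mul] at h2
    calc _ = (embedAt (m := Fin M) start)ᴴ * (conjugator Pr (controlledSwap M b) h OF)ᴴ *
          centralUnitary M a *
          (conjugator Pr (controlledSwap M b) h OF * embedAt (m := Fin M) start) := by
          rw [encoding]; simp only [Matrix.mul_assoc]
      _ = _ := by rw [h2, hY]; simp only [Matrix.mul_assoc]
  rw [h1, basisColumns_conjTranspose_mul_mul]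
  ext i j
  rw [superpose_conj_apply, sum_centralUnitary_entryLabel]
  rfl

end BlockEncoding

/-! ### Precision of the encoding and choice of parameters -/

section Assembly

open Matrix
open scoped Matrix.Norms.L2Operator

variable {M b D : ℕ}

/-- The point closest to `w` in the disk of radius `L`. -/
noncomputable def clampDisk (L : ℝ) (w : ℂ) : ℂ := if ‖w‖ ≤ L then w else ((L / ‖w‖ : ℝ) : ℂ) * w

lemma norm_clampDisk_le {L : ℝ} (hL : 0 ≤ L) (w : ℂ) : ‖clampDisk L w‖ ≤ L := by
  rw [clampDisk]
  split_ifs with h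
  · exact h
  · have hw : 0 < ‖w‖ := hL.trans_lt (not_le.1 h)
    rw [norm_mul, Complex.norm_real, Real.norm_eq_abs, abs_of_nonneg (by positivity),
      div_mul_cancel₀ _ hw.ne']

/-- Bit strings may decode to numbers too large for `entryUnitary`. Clamping moves w by at most ‖w‖
- L ≤ ‖w‖ - ‖v‖ ≤ ζ, which doubles the error at worst. -/
lemma norm_clampDisk_sub_le {L ζ : ℝ} (hL : 0 ≤ L) {w v : ℂ} (hv : ‖v‖ ≤ L) (h : ‖w - v‖ ≤ ζ) :
    ‖clampDisk L w - v‖ ≤ 2 * ζ := by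
  have hζ : 0 ≤ ζ := (norm_nonneg _).trans h
  rw [clampDisk]
  split_ifs with hw
  · linarith
  · have hw0 : 0 < ‖w‖ := hL.trans_lt (not_le.1 hw)
    have h1 : ((L / ‖w‖ : ℝ) : ℂ) * w - v = (w - v) - ((1 - L / ‖w‖ : ℝ) : ℂ) * w := by
      push_cast; ring
    have h2 : 0 ≤ 1 - L / ‖w‖ := by
      rw [sub_nonneg, div_le_one hw0]; exact (not_le.1 hw).le
    have h3 : ‖((1 - L / ‖w‖ : ℝ) : ℂ) * w‖ ≤ ζ := by
      rw [norm_mul, Complex.norm_real, Real.norm_eq_abs, abs_of_nonneg h2, sub_mul,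
        div_mul_cancel₀ _ hw0.ne', one_mul]
      have := norm_sub_norm_le w v
      linarith
    rw [h1]
    refine (norm_sub_le _ _).trans ?_
    linarith

lemma norm_apply_le_maxNorm (H : Matrix (Fin M) (Fin M) ℂ) (i j : Fin M) :
    ‖H i j‖ ≤ maxNorm H :=
  le_ciSup (f := fun p : Fin M × Fin M => ‖H p.1 p.2‖) (Set.finite_range _).bddAbove (i, j)

/-- Combining each entry with the conjugate of the transposed one gives a Hermitian matrix even when
the rounded data are not Hermitian. -/
lemma encodedMatrix_isHermitian (f : Fin M → Fin D → Fin M) (h : Fin M → Fin M → Bits b)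
    (a : Bits b → ℂ) : (encodedMatrix f h a).IsHermitian := by
  ext i j
  simp only [encodedMatrix, conjTranspose_apply, of_apply]
  simp only [Complex.star_def, map_mul, map_add, map_div₀, map_one, map_ofNat, Complex.conj_natCast,
    Complex.conj_conj]
  ring

lemma listed_le_one {f : Fin M → Fin D → Fin M} (hf : ∀ j, Function.Injective (f j))
    (i j : Fin M) : listed f i j ≤ 1 := by
  rw [listed, Finset.card_le_one]
  intro k hk k' hk'
  simp only [Finset.mem_filter, Finset.mem_univ, true_and] at hk hk'
  exact hf j (hk.trans hk'.symm)

lemma sum_listed (f : Fin M → Fin D → Fin M) (j : Fin M) : ∑ i, listed f i j = D := by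
  have h := Finset.card_eq_sum_card_fiberwise (f := f j) (s := Finset.univ) (t := Finset.univ)
    (by simp)
  simpa [listed] using h.symm

/-- Error of the encoded matrix, for entries given to precision `ζ`. -/
lemma norm_encodedMatrix_sub_le {f : Fin M → Fin D → Fin M} (hf : ∀ j, Function.Injective (f j))
    (hD : 0 < D) {L ζ : ℝ} (hL : 0 < L) (hζ : 0 ≤ ζ) {h : Fin M → Fin M → Bits b}
    {dec : Bits b → ℂ} {H : Matrix (Fin M) (Fin M) ℂ} (hH : H.IsHermitian)
    (hHL : ∀ i j, ‖H i j‖ ≤ L) (hdec : ∀ i j, ‖dec (h i j) - H i j‖ ≤ ζ)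
    (hsupp : ∀ i j, H i j ≠ 0 → ∃ k, f j k = i) :
    ‖((D * L : ℝ) : ℂ) • encodedMatrix f h (fun z => clampDisk L (dec z) / L) - H‖ ≤
      2 * D * ζ := by
  have hA := encodedMatrix_isHermitian f h (fun z => clampDisk L (dec z) / L)
  refine norm_le_of_row_sum_le (IsHermitian.sub (by
    rw [IsHermitian, conjTranspose_smul, hA.eq]; simp) hH) (by positivity) fun i => ?_
  have hDc : (D : ℂ) ≠ 0 := by exact_mod_cast hD.ne'
  have hLc : (L : ℂ) ≠ 0 := by exact_mod_cast hL.ne'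
  have hpos : ∀ i j, H i j ≠ 0 → listed f i j = 1 := by
    intro i j hij
    refine le_antisymm (listed_le_one hf i j) ?_
    obtain ⟨k, hk⟩ := hsupp i j hij
    exact Finset.card_pos.2 ⟨k, by simp [hk]⟩
  have hentry : ∀ j, ‖(((D * L : ℝ) : ℂ) • encodedMatrix f h (fun z => clampDisk L (dec z) / L) -
      H) i j‖ ≤ 2 * ζ * listed f j i := by
    intro j
    have hji : H j i = starRingEnd ℂ (H i j) := (hH.apply j i).symm
    have heq : (((D * L : ℝ) : ℂ) • encodedMatrix f h (fun z => clampDisk L (dec z) / L) -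
        H) i j = (1 / 2) * ((listed f i j * listed f j i : ℂ) *
          (clampDisk L (dec (h i j)) + starRingEnd ℂ (clampDisk L (dec (h j i))))) - H i j := by
      simp only [encodedMatrix, Matrix.sub_apply, Matrix.smul_apply, of_apply, smul_eq_mul, map_div₀,
        Complex.conj_ofReal]
      push_cast
      field_simp
    rw [heq]
    -- Hermiticity makes both transposed entries nonzero at once, so a nonzero entry is listed in
    -- both directions and nothing of H is lost.
    have h0 : listed f i j * listed f j i = 0 → H i j = 0 := by
      intro h0
      by_contra hne
      have hne' : H j i ≠ 0 := by rw [hji]; simpa using hne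
      rw [hpos i j hne, hpos j i hne'] at h0
      simp at h0
    by_cases hz : listed f i j * listed f j i = 0
    · have hz' : (listed f i j * listed f j i : ℂ) = 0 := by exact_mod_cast hz
      rw [h0 hz, hz']
      simp only [zero_mul, mul_zero, sub_zero, norm_zero]
      positivity
    · have h1 : listed f i j = 1 := le_antisymm (listed_le_one hf i j)
        (Nat.pos_of_ne_zero fun h => hz (by simp [h]))
      have h2 : listed f j i = 1 := le_antisymm (listed_le_one hf j i)
        (Nat.pos_of_ne_zero fun h => hz (by simp [h]))
      rw [h1, h2]
      have e1 := norm_clampDisk_sub_le hL.le (hHL i j) (hdec i j)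
      have e2 := norm_clampDisk_sub_le hL.le (hHL j i) (hdec j i)
      have heq2 : (1 / 2) * ((((1 : ℕ) : ℂ) * ((1 : ℕ) : ℂ)) *
          (clampDisk L (dec (h i j)) + starRingEnd ℂ (clampDisk L (dec (h j i))))) - H i j =
          (1 / 2) * ((clampDisk L (dec (h i j)) - H i j) +
            starRingEnd ℂ (clampDisk L (dec (h j i)) - H j i)) := by
        rw [map_sub, hji, Complex.conj_conj]; push_cast; ring
      rw [heq2, norm_mul]
      have e3 := norm_add_le (clampDisk L (dec (h i j)) - H i j)
        (starRingEnd ℂ (clampDisk L (dec (h j i)) - H j i))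
      rw [RCLike.norm_conj] at e3
      have e4 : ‖(1 / 2 : ℂ)‖ = 1 / 2 := by simp
      rw [e4]
      push_cast
      linarith
  -- Column i lists exactly D rows, so the row sum of the error bounds is 2ζD.
  refine (Finset.sum_le_sum fun j _ => hentry j).trans (le_of_eq ?_)
  rw [← Finset.mul_sum, ← Nat.cast_sum, sum_listed]
  ring

/-- Distinct columns of a unitary are orthogonal, whereas a repeated index would give two equal
basis vectors. -/
lemma IsSparsityOracle.injective {hD : D ≤ M} {OF : Matrix (Fin M × Fin M) (Fin M × Fin M) ℂ}
    (hOF : OF ∈ unitaryGroup (Fin M × Fin M) ℂ) {f : Fin M → Fin D → Fin M}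
    (hf : ∀ (j : Fin M) (k : Fin D) (x : Fin M × Fin M),
      OF x (j, Fin.castLE hD k) = if x = (j, f j k) then 1 else 0) (j : Fin M) :
    Function.Injective (f j) := by
  intro k k' hk
  by_contra hne
  have h := congrFun (congrFun (mem_unitaryGroup_iff'.1 hOF) (j, Fin.castLE hD k))
    (j, Fin.castLE hD k')
  rw [mul_apply, one_apply_ne (by simpa [Fin.castLE_inj] using hne)] at h
  simp [star_apply, hf, hk] at h

/-- The algorithm without gates simulates the zero Hamiltonian. -/
lemma simulates_zero (hM : 0 < M) : ∃ A : QueryAlgorithm M b, A.queries = 0 ∧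
    ∀ h OF (t : ℝ) {δ : ℝ}, 0 ≤ δ → A.Simulates h OF 0 t δ := by
  refine ⟨⟨Unit, (((⟨0, hM⟩, ⟨0, hM⟩), 0), ()), []⟩, rfl, fun h OF t δ hδ ρ hρ => ?_⟩
  have hev : evolution (0 : Matrix (Fin M) (Fin M) ℂ) t = 1 := by simp [evolution]
  rw [hev]
  refine (traceDist_traceOutRight_le (κ := 0) (one_mem _) (one_mem _) hρ (le_of_eq ?_)).trans
    (by linarith)
  rw [norm_eq_zero, sub_eq_zero]
  ext i j
  simp [one_apply]

end Assembly

end HamSim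

theorem theorem1 :
    ∃ C : ℝ, 0 < C ∧ ∃ c : ℝ, 0 < c ∧
      ∀ (M D b : ℕ) (_hM : 0 < M) (hD : D ≤ M) (dec : HamSim.Bits b → ℂ)
        (La Lm t δ ζ : ℝ), 0 ≤ La → 0 ≤ Lm → 0 ≤ t → 0 < δ → δ ≤ 1 →
        0 ≤ ζ → (D : ℝ) * t * ζ ≤ c * δ →
        ∃ A : HamSim.QueryAlgorithm M b,
          (A.queries : ℝ) ≤ C * (La * t / Real.sqrt δ + (D : ℝ) * Lm * t + 1) ∧
          ∀ (H : Matrix (Fin M) (Fin M) ℂ) (h : Fin M → Fin M → HamSim.Bits b)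
            (OF : Matrix (Fin M × Fin M) (Fin M × Fin M) ℂ),
            H.IsHermitian → HamSim.specNorm H ≤ La → HamSim.maxNorm H ≤ Lm →
            (∀ j k : Fin M, ‖dec (h j k) - H j k‖ ≤ ζ) →
            HamSim.IsSparsityOracle hD H OF →
            A.Simulates h OF H t δ := by
  open HamSim in
  open scoped Matrix.Norms.L2Operator in
  -- Degree 3K costs 36K queries, and K ≤ 12Y + 1 ≤ 13Y with Y the bracket of the query bound, so
  -- 36·13 = 468. The value 1/16 gives 2Dζt ≤ δ/8.
  refine ⟨468, by norm_num, 1 / 16, by norm_num, ?_⟩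
  intro M D b hM hD dec La Lm t δ ζ hLa hLm ht hδ hδ1 hζ hc
  have hYpos : 0 ≤ La * t / Real.sqrt δ := by positivity
  have hτ : 0 ≤ (D : ℝ) * Lm * t := by positivity
  -- Here the normalization D·Lm of the encoding vanishes, but so does H.
  by_cases hzero : D = 0 ∨ Lm = 0
  · obtain ⟨A, hA, hsim⟩ := simulates_zero (b := b) hM
    refine ⟨A, by rw [hA]; push_cast; positivity, fun H h OF _ _ hmax _ hOF => ?_⟩
    have hH0 : H = 0 := by
      ext i j
      by_contra hne
      rcases hzero with h0 | h0
      · obtain ⟨k, -⟩ := hOF.2.choose_spec.2 i j hne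
        subst h0
        exact k.elim0
      · have := norm_apply_le_maxNorm H i j
        exact hne (norm_le_zero_iff.1 (by linarith))
    rw [hH0]
    exact hsim h OF t hδ.le
  obtain ⟨hD0, hLm0⟩ := not_or.1 hzero
  have hDpos : 0 < D := Nat.pos_of_ne_zero hD0
  have hLpos : 0 < Lm := lt_of_le_of_ne hLm (Ne.symm hLm0)
  set Y := La * t / Real.sqrt δ + (D : ℝ) * Lm * t + 1 with hY
  set K := ⌈12 * Y⌉₊ with hK
  have hKY : 12 * Y ≤ K := Nat.le_ceil _
  have hKY' : (K : ℝ) ≤ 12 * Y + 1 := (Nat.ceil_lt_add_one (by positivity)).le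
  have hK3 : 3 ≤ K := by
    have : (3 : ℝ) ≤ K := by linarith
    exact_mod_cast this
  have hs : 0 < Real.sqrt δ := Real.sqrt_pos.2 hδ
  have hsδ : δ ≤ Real.sqrt δ := by
    have h1 : Real.sqrt δ ≤ 1 := Real.sqrt_le_one.2 hδ1
    have h2 := Real.mul_self_sqrt hδ.le
    nlinarith
  -- The margin δ/8 in x covers the spectrum of the encoded matrix, whose rescaling differs from H
  -- by at most 2Dζ.
  obtain ⟨q, hq, hq1, hqE⟩ := exists_evolution_polynomial (K := K) (τ := D * Lm * t)
    (x := La * t + δ / 8) hτ hδ hδ1 (by positivity) hK3 (by linarith) (by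
      have h1 : La * t / Real.sqrt δ * Real.sqrt δ = La * t := div_mul_cancel₀ _ hs.ne'
      have h2 : 12 * Y * Real.sqrt δ ≤ K * Real.sqrt δ := mul_le_mul_of_nonneg_right hKY hs.le
      have h3 : 0 ≤ (D : ℝ) * Lm * t * Real.sqrt δ := by positivity
      have h4 : Y * Real.sqrt δ = La * t + (D : ℝ) * Lm * t * Real.sqrt δ + Real.sqrt δ := by
        rw [hY, add_mul, add_mul, h1, one_mul]
      linarith)
  obtain ⟨start, Pr, hPr, hblock⟩ := exists_preparation b hM hD hDpos
  have ha : ∀ z, ‖clampDisk Lm (dec z) / (Lm : ℂ)‖ ≤ 1 := fun z => by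
    rw [norm_div, Complex.norm_real, Real.norm_eq_abs, abs_of_pos hLpos, div_le_one hLpos]
    exact norm_clampDisk_le hLm _
  obtain ⟨A, hA, hAop⟩ := exists_transformation_algorithm start hPr
    (controlledSwap_mem_unitaryGroup (M := M) (b := b))
    (centralUnitary_conjTranspose fun z => clampDisk Lm (dec z) / (Lm : ℂ))
    (centralUnitary_mul_self ha) hq hq1
  refine ⟨A, ?_, fun H h OF hH hspec hmax hdec hOF ρ hρ => ?_⟩
  · rw [hA]; push_cast; linarith
  obtain ⟨hOFu, f, hf, hsupp⟩ := hOF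
  obtain ⟨hU, hB⟩ := hAop h OF hOFu
  rw [hblock _ h OF f hf] at hB
  set E := encodedMatrix f h fun z => clampDisk Lm (dec z) / (Lm : ℂ) with hE
  have hEh : E.IsHermitian := encodedMatrix_isHermitian f h _
  have herr : ‖((D * Lm : ℝ) : ℂ) • E - H‖ ≤ 2 * D * ζ :=
    norm_encodedMatrix_sub_le (IsSparsityOracle.injective hOFu hf) hDpos hLpos hζ hH
      (fun i j => (norm_apply_le_maxNorm H i j).trans hmax) hdec hsupp
  have hspec' : ‖H‖ ≤ La := hspec
  have hsmul : (((D * Lm : ℝ) : ℂ) • E).IsHermitian := by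
    rw [Matrix.IsHermitian, Matrix.conjTranspose_smul, hEh.eq]; simp
  have hnorm : (D : ℝ) * Lm * t * ‖E‖ ≤ La * t + δ / 8 := by
    have h1 : ‖((D * Lm : ℝ) : ℂ) • E‖ = D * Lm * ‖E‖ := by
      rw [norm_smul, Complex.norm_real, Real.norm_eq_abs, abs_of_nonneg (by positivity)]
    have h2 : ‖((D * Lm : ℝ) : ℂ) • E‖ ≤ 2 * D * ζ + La := by
      have := norm_add_le (((D * Lm : ℝ) : ℂ) • E - H) H
      rw [sub_add_cancel] at this
      linarith
    have h3 := mul_le_mul_of_nonneg_right (h1 ▸ h2) ht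
    linarith
  have h1 := norm_aeval_sub_exp_le hEh hτ hnorm (by positivity) hqE
  have h2 : NormedSpace.exp ((-(Complex.I * ((D * Lm * t : ℝ) : ℂ))) • E) =
      evolution (((D * Lm : ℝ) : ℂ) • E) t := by
    rw [evolution, smul_smul]; push_cast; ring_nf
  rw [h2] at h1
  have h3 := norm_evolution_sub_le hsmul hH ht
  -- The polynomial contributes 3δ/10 and the imprecise entries δ/8; discarding the ancillas then
  -- doubles δ/2 to δ.
  have h4 : ‖Polynomial.aeval E q - evolution H t‖ ≤ δ / 2 := by
    have h5 := norm_sub_le_norm_sub_add_norm_sub (Polynomial.aeval E q)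
      (evolution (((D * Lm : ℝ) : ℂ) • E) t) (evolution H t)
    have h6 := mul_le_mul_of_nonneg_left herr ht
    linarith
  rw [← hB] at h4
  exact (traceDist_traceOutRight_le hU (evolution_mem_unitaryGroup hH t) hρ h4).trans
    (by linarith)
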